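/- Let $\mathbb{X}$ be a locally compact second-countable Hausdorff topological group with neutral element $e$ and left Haar measure $\lambda$, and suppose $\mathbb{X}$ is unimodular (i.e. $\lambda(Bx)=\lambda(B)$ for all Borel $B$ and $x\in\mathbb{X}$). Let $(\Omega,\mathcal{A},\mathbf{P})$ be a probability space with a jointly measurable, $\mathbf{P}$-preserving left action $(x,\omega)\mapsto\theta_x\omega$ of $\mathbb{X}$. Let $\mathbf{M}$ be the space of locally finite counting measures on $\mathbb{X}$ with the $\sigma$-algebra generated by the maps $\mu\mapsto\mu(B)$, $B$ Borel, and put $T_x\mu(B):=\mu(x^{-1}B)$. Let $\mathfrak{m}:\Omega\to\mathbf{M}$ be measurable, almost surely simple (every atom has mass $1$; $\mathfrak m$ is identified with its set of atoms), and flow-adapted: $\mathfrak{m}(\theta_x\omega)=T_x\mathfrak{m}(\omega)$ for all $x,\omega$. Suppose that $\mathbf{E}[\mathfrak{m}(\cdot)]$ is locally finite and not the zero measure, so that the intensity $\gamma=\mathbf{E}[\mathfrak{m}(B)]/\lambda(B)$ (for any Borel $B$ with $0<\lambda(B)<\infty$) lies in $(0,\infty)$. The Palm probability measure of $\mathfrak{m}$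 is $$\mathbf{P}^{\mathfrak{m}}(A)=\frac1\gamma\,\mathbf{E}\int_{\mathbb{X}}1_{\{\theta_x^{-1}\omega\in A\}}\,w(x)\,\mathfrak{m}(\omega,dx),\qquad A\in\mathcal{A},$$ where $w:\mathbb{X}\to[0,\infty)$ is any measurable function with $\int w\,d\lambda=1$. Suppose that $\mathfrak{m}$ is connectible in a flow-adapted way: there is a family of simple undirected graphs $\boldsymbol G(\omega)$, $\omega\in\Omega$, with vertices in $\mathbb{X}$, such that * for all $\omega\in\Omega$, $z\in\mathbb{X}$, the graph $\boldsymbol G(\theta_z\omega)$ is the left translate of $\boldsymbol G(\omega)$ by $z$; * almost surely $\boldsymbol G$ is connected (the empty graph being allowed), locally finite, and has vertex set $\mathfrak{m}$; * there are measurable $N:\Omega\to\mathbb{N}\cup\{\infty\}$ and $Y_i:\Omega\to\mathbb{X}$ such that almost surely $\mathfrak{m}=\sum_{i<N}\delta_{Y_i}$, and the event that $i,j<N$ and $\{Y_i,Y_j\}$ is an edge of $\boldsymbol G$ is measurable for all $i,j$. A network with mark space $\Xi$ (a complete separable metric space) is a connected locally finite graph $G$ with a mark in $\Xi$ for every vertex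 and for every pair $(v,g)$ of a vertex $v$ and an edge $g$ at $v$. Let $\mathcal{G}_*$ and $\mathcal{G}_{**}$ be the sets of isomorphism classes $[G,o]$ and $[G,o,v]$ of networks with one, respectively two, distinguished vertices, with the Borel $\sigma$-algebras of the local topology (two classes are close if, for some large $r$, the balls of radius $r$ around the distinguished vertices are isomorphic, respecting the distinguished vertices, with corresponding marks at distance at most $1/r$). Then the Palm version of $\mathfrak{m}$ is an $\mathbb{X}$-embedding of some unimodular random network. That is, there are a complete separable metric space $\Xi$, a measurable $[\boldsymbol{\Gamma},\boldsymbol{o}]:\Omega\to\mathcal{G}_*$ and a measurable $\psi:\mathcal{G}_*\to\mathbf{M}$ such that: 1. $\mathbf{P}^{\mathfrak{m}}$ is a probability measure and $[\boldsymbol\Gamma,\boldsymbol o]$ is unimodular under it: for all measurable $g:\mathcal{G}_{**}\to[0,\infty]$, $$\mathbf{E}^{\mathfrak{m}}\sum_{v\in V(\boldsymbol\Gamma)}g[\boldsymbol\Gamma,\boldsymbol o,v]=\mathbf{E}^{\mathfrak{m}}\sum_{v\in V(\boldsymbol\Gamma)}g[\boldsymbol\Gamma,v,\boldsymbol o];$$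 2. $e\in\psi[G,o]$ for all $[G,o]\in\mathcal{G}_*$; 3. there is a measurable $t:\mathcal{G}_{**}\to\mathbb{X}$ such that, for every network $G$ and all $o,v\in V(G)$, $\psi[G,v]=T_{t[G,o,v]^{-1}}\psi[G,o]$ and $t[G,v,o]=t[G,o,v]^{-1}$, and such that $\mathbf{P}^{\mathfrak{m}}$-almost surely $v\mapsto t[\boldsymbol\Gamma,\boldsymbol o,v]$ is a bijection from $V(\boldsymbol\Gamma)$ onto the support of $\psi[\boldsymbol\Gamma,\boldsymbol o]$; 4. $\mathfrak{m}=\psi[\boldsymbol\Gamma,\boldsymbol o]$ $\mathbf{P}^{\mathfrak{m}}$-almost surely. -/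

import Mathlib

open MeasureTheory Filter Set
open scoped ENNReal NNReal Topology

universe u v

namespace PalmNetwork

/-! ## Point processes on a locally compact second countable Hausdorff group -/

section PointProcess

/-- The space `𝐌` of locally finite counting measures on `X`.  As a subtype of `Measure X` it
carries the cylindrical sigma-algebra, generated by the maps `μ ↦ μ B`, `B` measurable. -/
def CountingMeasure (X : Type u) [TopologicalSpace X] [MeasurableSpace X] : Type u :=
  {μ : Measure X // IsLocallyFiniteMeasure μ ∧
    ∀ B : Set X, MeasurableSet B → ∃ n : ℕ∞, μ B = (n : ℝ≥0∞)}

instance (X : Type u) [TopologicalSpace X] [MeasurableSpace X] :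
    MeasurableSpace (CountingMeasure X) :=
  inferInstanceAs (MeasurableSpace (Subtype _))

instance (X : Type u) [TopologicalSpace X] [MeasurableSpace X] :
    CoeOut (CountingMeasure X) (Measure X) :=
  ⟨Subtype.val⟩

/-- The support of a locally finite counting measure, i.e. the set of its atoms. -/
def points {X : Type u} [TopologicalSpace X] [MeasurableSpace X] (μ : CountingMeasure X) :
    Set X :=
  {x | (μ : Measure X) {x} ≠ 0}

/-- Every atom has mass one. -/
def IsSimple {X : Type u} [TopologicalSpace X] [MeasurableSpace X] (μ : CountingMeasure X) :
    Prop :=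
  ∀ x ∈ points μ, (μ : Measure X) {x} = 1

/-- The translate `T_x μ`, with `T_x μ (B) = μ (x⁻¹ B)`. -/
noncomputable def leftTranslate {X : Type u} [Group X] [MeasurableSpace X] (x : X) (μ : Measure X) :
    Measure X :=
  μ.map (fun y => x * y)

/-- A point process `m` is flow-adapted if `m (θ_x ω) = T_x (m ω)` for all `x` and all `ω`; the
flow `θ_x ω` is the action `x • ω`. -/
def FlowAdapted {X : Type u} [Group X] [TopologicalSpace X] [MeasurableSpace X]
    {Ω : Type v} [MulAction X Ω] (m : Ω → CountingMeasure X) : Prop :=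
  ∀ (x : X) (ω : Ω), (m (x • ω) : Measure X) = leftTranslate x (m ω)

/-- The mean measure `Λ(B) = E[m(B)]`. -/
noncomputable def meanMeasure {X : Type u} [TopologicalSpace X] [MeasurableSpace X]
    {Ω : Type v} [MeasurableSpace Ω] (P : Measure Ω) (m : Ω → CountingMeasure X) : Measure X :=
  P.bind (fun ω => (m ω : Measure X))

/-- The intensity `E[m(K)] / haar(K)`, evaluated at one fixed compact set `K` with non-empty
interior; `intensity_eq` shows that any measurable set of positive finite Haar measure gives the
same value. -/
noncomputable def intensity {X : Type u} [Group X] [TopologicalSpace X] [LocallyCompactSpace X]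
    [MeasurableSpace X] {Ω : Type v} [MeasurableSpace Ω]
    (P : Measure Ω) (haar : Measure X) (m : Ω → CountingMeasure X) : ℝ≥0∞ :=
  meanMeasure P m (Classical.arbitrary (TopologicalSpace.PositiveCompacts X) : Set X) /
    haar (Classical.arbitrary (TopologicalSpace.PositiveCompacts X) : Set X)

/-- The Palm probability measure
`A ↦ (1 / intensity) * E [ ∫ 1_{θ_x⁻¹ ω ∈ A} w(x) m(ω, dx) ]`
computed with the weight function `w` (see `palm_apply`). -/
noncomputable def palm {X : Type u} [Group X] [TopologicalSpace X] [LocallyCompactSpace X]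
    [MeasurableSpace X] {Ω : Type v} [MeasurableSpace Ω] [MulAction X Ω]
    (P : Measure Ω) (haar : Measure X) (m : Ω → CountingMeasure X) (w : X → ℝ≥0) : Measure Ω :=
  (intensity P haar m)⁻¹ •
    P.bind (fun ω =>
      ((m ω : Measure X).withDensity (fun x => (w x : ℝ≥0∞))).map (fun x => x⁻¹ • ω))


variable {X : Type u} [Group X] [TopologicalSpace X] [IsTopologicalGroup X]
  [LocallyCompactSpace X] [SecondCountableTopology X] [T2Space X]
  [MeasurableSpace X] [BorelSpace X]
  {Ω : Type v} [MeasurableSpace Ω]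

theorem measurable_coe_measure {m : Ω → CountingMeasure X} (hm : Measurable m) :
    Measurable (fun ω => (m ω : Measure X)) :=
  measurable_subtype_coe.comp hm

theorem isSFiniteKernel_of_finite {κ : ProbabilityTheory.Kernel Ω X}
    (h : ∀ ω, κ ω univ < ∞) : ProbabilityTheory.IsSFiniteKernel κ := by
  classical
  let S : ℕ → Set Ω := fun k => (fun ω => κ ω univ) ⁻¹' (Ico (k : ℝ≥0∞) (k + 1))
  have hS : ∀ k, MeasurableSet (S k) := fun k =>
    (ProbabilityTheory.Kernel.measurable_coe κ MeasurableSet.univ) measurableSet_Ico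
  let κs : ℕ → ProbabilityTheory.Kernel Ω X := fun k =>
    ProbabilityTheory.Kernel.piecewise (hS k) κ 0
  have hfin : ∀ k, ProbabilityTheory.IsFiniteKernel (κs k) := by
    intro k
    refine ⟨⟨(k : ℝ≥0∞) + 1, by finiteness, fun ω => ?_⟩⟩
    simp only [κs, ProbabilityTheory.Kernel.piecewise_apply]
    split_ifs with hω
    · exact hω.2.le
    · simp
  have hsum : κ = ProbabilityTheory.Kernel.sum κs := by
    ext ω s hs
    rw [ProbabilityTheory.Kernel.sum_apply' _ _ hs]
    set k₀ := ⌊(κ ω univ).toNNReal⌋₊ with hk₀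
    have hcoe : κ ω univ = ((κ ω univ).toNNReal : ℝ≥0∞) := (ENNReal.coe_toNNReal (h ω).ne).symm
    have hmem : ∀ k, ω ∈ S k ↔ k = k₀ := by
      intro k
      simp only [S, mem_preimage, mem_Ico]
      rw [hcoe]
      have h1 : ((k : ℝ≥0∞) ≤ ((κ ω univ).toNNReal : ℝ≥0∞)) ↔
          ((k : ℝ≥0) ≤ (κ ω univ).toNNReal) := by exact_mod_cast Iff.rfl
      have h2 : (((κ ω univ).toNNReal : ℝ≥0∞) < (k : ℝ≥0∞) + 1) ↔
          ((κ ω univ).toNNReal < (k : ℝ≥0) + 1) := by exact_mod_cast Iff.rfl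
      rw [h1, h2, hk₀, eq_comm, Nat.floor_eq_iff (zero_le)]
    rw [tsum_eq_single k₀]
    · simp [κs, ProbabilityTheory.Kernel.piecewise_apply, (hmem k₀).2 rfl]
    · intro k hk
      have : ω ∉ S k := fun h' => hk ((hmem k).1 h')
      simp [κs, ProbabilityTheory.Kernel.piecewise_apply, this]
  rw [hsum]
  exact ProbabilityTheory.Kernel.isSFiniteKernel_sum

/-- A point process is an s-finite kernel, so integrals against it are measurable in `ω`. -/
theorem isSFiniteKernel_pointProcess {m : Ω → CountingMeasure X} (hm : Measurable m) :
    ProbabilityTheory.IsSFiniteKernel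
      (⟨fun ω => (m ω : Measure X), measurable_coe_measure hm⟩ :
        ProbabilityTheory.Kernel Ω X) := by
  set κ : ProbabilityTheory.Kernel Ω X :=
    ⟨fun ω => (m ω : Measure X), measurable_coe_measure hm⟩ with hκ
  let B : ℕ → Set X := disjointed (compactCovering X)
  have hB : ∀ n, MeasurableSet (B n) := fun n =>
    MeasurableSet.disjointed (fun k => (isCompact_compactCovering X k).measurableSet) n
  have hBfin : ∀ n ω, κ ω (B n) < ∞ := by
    intro n ω
    have : IsLocallyFiniteMeasure (m ω : Measure X) := (m ω).2.1
    exact lt_of_le_of_lt (measure_mono (disjointed_subset _ n))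
      (isCompact_compactCovering X n).measure_lt_top
  have hsum : κ = ProbabilityTheory.Kernel.sum (fun n => κ.restrict (hB n)) := by
    ext ω s hs
    rw [ProbabilityTheory.Kernel.sum_apply' _ _ hs]
    simp only [ProbabilityTheory.Kernel.restrict_apply' _ _ _ hs]
    rw [← measure_iUnion, ← inter_iUnion, iUnion_disjointed, iUnion_compactCovering, inter_univ]
    · exact fun i j hij => ((disjoint_disjointed _) hij).mono inter_subset_right inter_subset_right
    · exact fun n => hs.inter (hB n)
  rw [hsum]
  have : ∀ n, ProbabilityTheory.IsSFiniteKernel (κ.restrict (hB n)) := by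
    refine fun n => isSFiniteKernel_of_finite fun ω => ?_
    rw [ProbabilityTheory.Kernel.restrict_apply' _ _ _ MeasurableSet.univ, univ_inter]
    exact hBfin n ω
  exact ProbabilityTheory.Kernel.isSFiniteKernel_sum

theorem meanMeasure_apply {P : Measure Ω} {m : Ω → CountingMeasure X} (hm : Measurable m)
    {B : Set X} (hB : MeasurableSet B) :
    meanMeasure P m B = ∫⁻ ω, (m ω : Measure X) B ∂P :=
  Measure.bind_apply hB (measurable_coe_measure hm).aemeasurable

/-- The defining formula of the Palm probability measure. -/
theorem palm_apply [MulAction X Ω] [MeasurableSMul₂ X Ω] {P : Measure Ω} {haar : Measure X}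
    {m : Ω → CountingMeasure X} (hm : Measurable m) {w : X → ℝ≥0} (hw : Measurable w)
    {A : Set Ω} (hA : MeasurableSet A) :
    palm P haar m w A = (intensity P haar m)⁻¹ *
      ∫⁻ ω, ∫⁻ x, A.indicator (fun _ => (w x : ℝ≥0∞)) (x⁻¹ • ω) ∂(m ω : Measure X) ∂P := by
  have := isSFiniteKernel_pointProcess hm
  have hw' : Measurable fun x => (w x : ℝ≥0∞) := hw.coe_nnreal_ennreal
  have hx : ∀ ω : Ω, Measurable fun x : X => x⁻¹ • ω := fun ω =>
    measurable_inv.smul_const ω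
  have hval : ∀ (ω : Ω) {A : Set Ω}, MeasurableSet A →
      ((m ω : Measure X).withDensity (fun x => (w x : ℝ≥0∞))).map (fun x => x⁻¹ • ω) A =
        ∫⁻ x, A.indicator (fun _ => (w x : ℝ≥0∞)) (x⁻¹ • ω) ∂(m ω : Measure X) := by
    intro ω A hA
    rw [Measure.map_apply (hx ω) hA, withDensity_apply _ (hx ω hA),
      ← lintegral_indicator (hx ω hA)]
    rfl
  have hmeas : Measurable fun ω =>
      ((m ω : Measure X).withDensity (fun x => (w x : ℝ≥0∞))).map (fun x => x⁻¹ • ω) := by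
    refine Measure.measurable_of_measurable_coe _ fun A hA => ?_
    simp only [hval _ hA]
    have hf : Measurable (Function.uncurry fun (ω : Ω) (x : X) =>
        A.indicator (fun _ => (w x : ℝ≥0∞)) (x⁻¹ • ω)) := by
      have hset : MeasurableSet {p : Ω × X | p.2⁻¹ • p.1 ∈ A} :=
        (measurable_snd.inv.smul measurable_fst) hA
      exact (hw'.comp measurable_snd).indicator hset
    exact hf.lintegral_kernel_prod_right (κ :=
      (⟨fun ω => (m ω : Measure X), measurable_coe_measure hm⟩ : ProbabilityTheory.Kernel Ω X))
  rw [palm, Measure.smul_apply, smul_eq_mul, Measure.bind_apply hA hmeas.aemeasurable]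
  simp only [hval _ hA]

/-- The intensity does not depend on the set used to compute it. -/
theorem intensity_eq [MulAction X Ω] [MeasurableSMul₂ X Ω] {P : Measure Ω}
    [SMulInvariantMeasure X Ω P] {haar : Measure X} [haar.IsHaarMeasure]
    {m : Ω → CountingMeasure X} (hm : Measurable m) (hfa : FlowAdapted m)
    [IsLocallyFiniteMeasure (meanMeasure P m)]
    {B : Set X} (h0 : haar B ≠ 0) (h1 : haar B ≠ ∞) :
    intensity P haar m = meanMeasure P m B / haar B := by
  have : (meanMeasure P m).IsMulLeftInvariant := by
    refine ⟨fun x => ?_⟩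
    ext B hB
    have hpre : MeasurableSet ((fun y => x * y) ⁻¹' B) := measurable_const_mul x hB
    rw [Measure.map_apply (measurable_const_mul x) hB, meanMeasure_apply hm hpre,
      meanMeasure_apply hm hB]
    have hB' : Measurable fun ω => (m ω : Measure X) B :=
      (Measure.measurable_coe hB).comp (measurable_coe_measure hm)
    rw [← (measurePreserving_smul x P).lintegral_comp hB']
    refine lintegral_congr fun ω => ?_
    rw [hfa x ω, leftTranslate, Measure.map_apply (measurable_const_mul x) hB]
  have h := Measure.isMulLeftInvariant_eq_smul (meanMeasure P m) haar
  set c := Measure.haarScalarFactor (meanMeasure P m) haar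
  have key : ∀ C : Set X, haar C ≠ 0 → haar C ≠ ∞ → meanMeasure P m C / haar C = c := by
    intro C hC0 hC1
    rw [h, Measure.smul_apply, ENNReal.smul_def, smul_eq_mul]
    exact ENNReal.mul_div_cancel_right hC0 hC1
  rw [intensity, key B h0 h1, key]
  · exact (Measure.measure_pos_of_nonempty_interior haar
      (Classical.arbitrary (TopologicalSpace.PositiveCompacts X)).interior_nonempty).ne'
  · exact (Classical.arbitrary (TopologicalSpace.PositiveCompacts X)).isCompact.measure_lt_top.ne

end PointProcess

/-! ## Connectibility -/

/-- The point process `m` is connectible in a flow-adapted way: there is a random graph `G` with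
vertices in `X` (a subgraph of the complete simple graph on `X`) which is flow-adapted, almost
surely connected and locally finite with vertex set `m`, and measurable, in the sense that for some
measurable enumeration `m = ∑_{i < N} δ_{Y i}` the events `{Y i, Y j} ∈ E(G)` are measurable.  The
empty graph counts as connected, since `m` may be empty with positive probability. -/
def Connectible {X : Type u} [Group X] [TopologicalSpace X] [MeasurableSpace X]
    {Ω : Type v} [MeasurableSpace Ω] [MulAction X Ω] (P : Measure Ω)
    (m : Ω → CountingMeasure X) : Prop :=
  ∃ G : Ω → (⊤ : SimpleGraph X).Subgraph,
    (∀ (z : X) (ω : Ω),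
      (∀ x : X, x ∈ (G ω).verts ↔ z * x ∈ (G (z • ω)).verts) ∧
      (∀ x y : X, (G ω).Adj x y ↔ (G (z • ω)).Adj (z * x) (z * y))) ∧
    (∀ᵐ ω ∂P, (G ω).coe.Preconnected ∧ (∀ x ∈ (G ω).verts, ((G ω).neighborSet x).Finite) ∧
      (G ω).verts = points (m ω)) ∧
    ∃ (N : Ω → ℕ∞) (Y : ℕ → Ω → X), Measurable N ∧ (∀ i, Measurable (Y i)) ∧
      (∀ᵐ ω ∂P, (m ω : Measure X) =
        Measure.sum (fun i : {i : ℕ // (i : ℕ∞) < N ω} => Measure.dirac (Y i ω))) ∧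
      ∀ i j : ℕ, MeasurableSet {ω | (i : ℕ∞) < N ω ∧ (j : ℕ∞) < N ω ∧ (G ω).Adj (Y i ω) (Y j ω)}

/-! ## Networks -/

section Network

/-- A network with mark space `Ξ`: a connected locally finite graph with marks.  The edge mark of
the pair `(v, {v, w})` is `edgeMark v w`; only its values at adjacent `v`, `w` are meaningful. -/
structure Network (Ξ : Type u) where
  V : Type u
  graph : SimpleGraph V
  connected : graph.Connected
  locallyFinite : ∀ v, (graph.neighborSet v).Finite
  vertexMark : V → Ξ
  edgeMark : V → V → Ξ

/-- A network with `k` distinguished vertices. -/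
structure PointedNetwork (Ξ : Type u) (k : ℕ) extends Network Ξ where
  root : Fin k → V

/-- Isomorphism of networks, preserving marks and distinguished vertices. -/
def PointedNetwork.Isomorphic {Ξ : Type u} {k : ℕ} (A B : PointedNetwork Ξ k) : Prop :=
  ∃ φ : A.graph ≃g B.graph,
    (∀ v, A.vertexMark v = B.vertexMark (φ v)) ∧
    (∀ v w, A.graph.Adj v w → A.edgeMark v w = B.edgeMark (φ v) (φ w)) ∧
    ∀ i, φ (A.root i) = B.root i

instance PointedNetwork.setoid (Ξ : Type u) (k : ℕ) : Setoid (PointedNetwork Ξ k) where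
  r := PointedNetwork.Isomorphic
  iseqv :=
    { refl := fun _ => ⟨SimpleGraph.Iso.refl, fun _ => rfl, fun _ _ _ => rfl, fun _ => rfl⟩
      symm := by
        rintro A B ⟨φ, h1, h2, h3⟩
        refine ⟨φ.symm, fun v => ?_, fun v w hvw => ?_, fun i => ?_⟩
        · rw [h1, RelIso.apply_symm_apply]
        · rw [h2 _ _ (φ.symm.map_rel_iff.2 hvw), RelIso.apply_symm_apply,
            RelIso.apply_symm_apply]
        · rw [← h3 i, RelIso.symm_apply_apply]
      trans := by
        rintro A B C ⟨φ, h1, h2, h3⟩ ⟨ψ, g1, g2, g3⟩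
        refine ⟨φ.trans ψ, fun v => ?_, fun v w hvw => ?_, fun i => ?_⟩
        · rw [h1, g1]; rfl
        · rw [h2 _ _ hvw, g2 _ _ (φ.map_rel_iff.2 hvw)]; rfl
        · exact (congrArg ψ (h3 i)).trans (g3 i) }

/-- Isomorphism classes of networks with `k` distinguished vertices: `NetworkClass Ξ 1` is `𝒢_*`
and `NetworkClass Ξ 2` is `𝒢_**`. -/
def NetworkClass (Ξ : Type u) (k : ℕ) : Type (u + 1) :=
  Quotient (PointedNetwork.setoid Ξ k)

/-- The class `[G, o]`. -/
def rooted {Ξ : Type u} (G : Network Ξ) (o : G.V) : NetworkClass Ξ 1 :=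
  Quotient.mk _ { G with root := ![o] }

/-- The class `[G, o, v]`. -/
def birooted {Ξ : Type u} (G : Network Ξ) (o v : G.V) : NetworkClass Ξ 2 :=
  Quotient.mk _ { G with root := ![o, v] }

/-- The ball of radius `⌈r⌉` around the distinguished vertices. -/
noncomputable def PointedNetwork.ball {Ξ : Type u} {k : ℕ} (A : PointedNetwork Ξ k) (r : ℝ) :
    Set A.V :=
  {v | ∃ i, A.graph.dist (A.root i) v ≤ ⌈r⌉₊}

/-- `A` and `B` are `r`-close: the balls of radius `r` around the distinguished vertices are
isomorphic by an isomorphism of graphs which respects the distinguished vertices and moves marks by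
at most `1 / r`. -/
def PointedNetwork.Close {Ξ : Type u} [MetricSpace Ξ] {k : ℕ} (r : ℝ)
    (A B : PointedNetwork Ξ k) : Prop :=
  ∃ φ : A.graph.induce (A.ball r) ≃g B.graph.induce (B.ball r),
    (∀ i (v : A.ball r), (v : A.V) = A.root i → (φ v : B.V) = B.root i) ∧
    (∀ v : A.ball r, dist (A.vertexMark v) (B.vertexMark (φ v)) ≤ 1 / r) ∧
    ∀ v w : A.ball r, A.graph.Adj v w →
      dist (A.edgeMark v w) (B.edgeMark (φ v) (φ w)) ≤ 1 / r

/-- The local topology on isomorphism classes: `U` is open if for each `[A] ∈ U` there is `R` such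
that all `[B]` which are `r`-close to `[A]` for some `r > R` lie in `U`.  This says that `U`
contains a ball around each of its points for the distance `2 ^ (-α)`, where
`α = sup {r > 0 | A and B are r-close}`. -/
instance NetworkClass.topologicalSpace (Ξ : Type u) [MetricSpace Ξ] (k : ℕ) :
    TopologicalSpace (NetworkClass Ξ k) where
  IsOpen U := ∀ A : PointedNetwork Ξ k, Quotient.mk _ A ∈ U →
    ∃ R : ℝ, 0 < R ∧ ∀ r > R, ∀ B : PointedNetwork Ξ k, A.Close r B → Quotient.mk _ B ∈ U
  isOpen_univ := fun _ _ => ⟨1, one_pos, fun _ _ _ _ => mem_univ _⟩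
  isOpen_inter := by
    intro U V hU hV A hA
    obtain ⟨R, hR, h⟩ := hU A hA.1
    obtain ⟨S, _, h'⟩ := hV A hA.2
    exact ⟨max R S, lt_max_of_lt_left hR, fun r hr B hB =>
      ⟨h r ((le_max_left _ _).trans_lt hr) B hB, h' r ((le_max_right _ _).trans_lt hr) B hB⟩⟩
  isOpen_sUnion := by
    rintro 𝒰 h𝒰 A ⟨U, hU, hA⟩
    obtain ⟨R, hR, h⟩ := h𝒰 U hU A hA
    exact ⟨R, hR, fun r hr B hB => ⟨U, hU, h r hr B hB⟩⟩

instance NetworkClass.measurableSpace (Ξ : Type u) [MetricSpace Ξ] (k : ℕ) :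
    MeasurableSpace (NetworkClass Ξ k) :=
  borel _

theorem birooted_eq {Ξ : Type u} {A B : PointedNetwork Ξ 1} (φ : A.graph ≃g B.graph)
    (h1 : ∀ v, A.vertexMark v = B.vertexMark (φ v))
    (h2 : ∀ v w, A.graph.Adj v w → A.edgeMark v w = B.edgeMark (φ v) (φ w)) (v w : A.V) :
    birooted A.toNetwork v w = birooted B.toNetwork (φ v) (φ w) := by
  refine Quotient.sound ⟨φ, h1, h2, fun i => ?_⟩
  fin_cases i <;> rfl

/-- `∑_{v ∈ V(G)} g [G, o, v]` as a function of `[G, o]`. -/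
noncomputable def massOut {Ξ : Type u} (g : NetworkClass Ξ 2 → ℝ≥0∞) :
    NetworkClass Ξ 1 → ℝ≥0∞ :=
  Quotient.lift (fun A : PointedNetwork Ξ 1 =>
      ∑' v : A.V, g (birooted A.toNetwork (A.root 0) v)) (by
    rintro A B ⟨φ, h1, h2, h3⟩
    rw [← Equiv.tsum_eq φ.toEquiv]
    refine tsum_congr fun v => ?_
    rw [birooted_eq φ h1 h2, h3]
    rfl)

/-- `∑_{v ∈ V(G)} g [G, v, o]` as a function of `[G, o]`. -/
noncomputable def massIn {Ξ : Type u} (g : NetworkClass Ξ 2 → ℝ≥0∞) :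
    NetworkClass Ξ 1 → ℝ≥0∞ :=
  Quotient.lift (fun A : PointedNetwork Ξ 1 =>
      ∑' v : A.V, g (birooted A.toNetwork v (A.root 0))) (by
    rintro A B ⟨φ, h1, h2, h3⟩
    rw [← Equiv.tsum_eq φ.toEquiv]
    refine tsum_congr fun v => ?_
    rw [birooted_eq φ h1 h2, h3]
    rfl)

/-- `Γ = [G, o]` is a unimodular random network on the probability space `(Ω, Q)`. -/
structure IsUnimodularNetwork {Ξ : Type u} [MetricSpace Ξ] {Ω : Type v} [MeasurableSpace Ω]
    (Q : Measure Ω) (Γ : Ω → NetworkClass Ξ 1) : Prop where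
  isProbabilityMeasure : IsProbabilityMeasure Q
  measurable : Measurable Γ
  massTransport : ∀ g : NetworkClass Ξ 2 → ℝ≥0∞, Measurable g →
    ∫⁻ ω, massOut g (Γ ω) ∂Q = ∫⁻ ω, massIn g (Γ ω) ∂Q

/-- `ψ : 𝒢_* → 𝐌` is an `X`-embedding of the random network `Γ` with respect to `Q`. -/
structure IsEmbedding {X : Type u} [Group X] [TopologicalSpace X] [MeasurableSpace X]
    {Ξ : Type u} [MetricSpace Ξ] {Ω : Type v} [MeasurableSpace Ω] (Q : Measure Ω)
    (Γ : Ω → NetworkClass Ξ 1) (ψ : NetworkClass Ξ 1 → CountingMeasure X) : Prop where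
  measurable : Measurable ψ
  one_mem : ∀ a, (1 : X) ∈ points (ψ a)
  exists_transition : ∃ t : NetworkClass Ξ 2 → X, Measurable t ∧
    (∀ (G : Network Ξ) (o v : G.V),
      (ψ (rooted G v) : Measure X) = leftTranslate (t (birooted G o v))⁻¹ (ψ (rooted G o)) ∧
      t (birooted G v o) = (t (birooted G o v))⁻¹) ∧
    ∀ᵐ ω ∂Q, ∀ (G : Network Ξ) (o : G.V), Γ ω = rooted G o →
      BijOn (fun v => t (birooted G o v)) univ (points (ψ (Γ ω)))

end Network

end PalmNetwork

open PalmNetwork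

/-!
Root the graph at a point of `𝔪`, give all vertices the same mark and the edge from `x` to `y` the
mark `x⁻¹ y`. Marks, hence isomorphism classes, do not change under translations, and the product of
the marks along any walk from `x` to `y` is `x⁻¹ y`; so the products along walks from the root
recover all points as seen from the root. For an arbitrary network in which products along walks
depend only on the end points, they define `t`, and the image of the vertices is `ψ`; networks that
are not of this kind, or whose image is not locally finite, are sent to the unit mass at `e`.

Unimodularity of the resulting network is the exchange formula for the Palm measure: by invariance
of the counting measure on pairs of points under the diagonal action, and unimodularity of the
group, a weight at the first point may be traded for a weight at the second.

The random network is measurable because countably many finite patterns describe all balls up to a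
small error in the marks, so that a neighbourhood of a network is a countable union of events that
some pattern is realized. To get rid of the null set where the graph is bad without losing
equivariance, one keeps the configurations almost all of whose translates, with respect to Haar
measure, are good.
-/

namespace PalmNetwork

/-! ## Haar measure and mass transport -/

section Group

theorem isCompletelyMetrizableSpace_of_locallyCompactSpace (X : Type*) [Group X]
    [TopologicalSpace X] [IsTopologicalGroup X] [LocallyCompactSpace X]
    [FirstCountableTopology X] [T0Space X] : TopologicalSpace.IsCompletelyMetrizableSpace X := by
  let _ : UniformSpace X := IsTopologicalGroup.rightUniformSpace X
  have : IsRightUniformGroup X := ⟨rfl⟩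
  have : CompleteSpace X := IsRightUniformGroup.completeSpace_of_weaklyLocallyCompactSpace
  have : (uniformity X).IsCountablyGenerated := by
    rw [uniformity_eq_comap_nhds_one]
    infer_instance
  infer_instance

theorem isMulRightInvariant_of_measure_image {X : Type*} [Group X] [MeasurableSpace X]
    [MeasurableMul X] {μ : Measure X}
    (h : ∀ (x : X) (B : Set X), MeasurableSet B → μ ((fun y => y * x) '' B) = μ B) :
    μ.IsMulRightInvariant := by
  refine ⟨fun x => Measure.ext fun B hB => ?_⟩
  rw [Measure.map_apply (measurable_mul_const x) hB, ← h x⁻¹ B hB, image_mul_right, inv_inv]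

theorem isInvInvariant_of_isMulRightInvariant {X : Type*} [Group X] [TopologicalSpace X]
    [IsTopologicalGroup X] [LocallyCompactSpace X] [SecondCountableTopology X]
    [MeasurableSpace X] [BorelSpace X] (μ : Measure X) [μ.IsHaarMeasure]
    [μ.IsMulRightInvariant] : μ.IsInvInvariant := by
  have : IsFiniteMeasureOnCompacts μ.inv :=
    ⟨fun K hK => (Measure.inv_apply μ K).trans_lt hK.inv.measure_lt_top⟩
  have hμ := Measure.isMulLeftInvariant_eq_smul μ.inv μ
  set c := Measure.haarScalarFactor μ.inv μ
  let K := Classical.arbitrary (TopologicalSpace.PositiveCompacts X)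
  let L : Set X := K ∪ (K : Set X)⁻¹
  have hL_compact : IsCompact L := K.isCompact.union K.isCompact.inv
  have hL_ne_zero : μ L ≠ 0 := ((Measure.measure_pos_of_nonempty_interior μ
    K.interior_nonempty).trans_le (measure_mono subset_union_left)).ne'
  have hL_inv : L⁻¹ = L := by simp only [L, union_inv, inv_inv, union_comm]
  have hcL : (c : ℝ≥0∞) * μ L = 1 * μ L :=
    calc (c : ℝ≥0∞) * μ L = μ.inv L := by rw [hμ]; rfl
      _ = 1 * μ L := by rw [Measure.inv_apply, hL_inv, one_mul]
  have hc : c = 1 := by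
    exact_mod_cast (ENNReal.mul_left_inj hL_ne_zero hL_compact.measure_lt_top.ne).1 hcL
  exact ⟨by rw [hμ, hc, one_smul]⟩

end Group

section MassTransport

open ProbabilityTheory

variable {X : Type*} [Group X]

theorem lintegral_weight_swap [MeasurableSpace X] [MeasurableMul₂ X] [MeasurableInv X]
    {S : Type*} [MeasurableSpace S] [MulAction X S] [MeasurableConstSMul X S]
    {M : Measure S} [SFinite M]
    [SMulInvariantMeasure X S M] {μ : Measure X} [SFinite μ] [μ.IsMulRightInvariant]
    [μ.IsInvInvariant] {w : X → ℝ≥0∞} (hw : Measurable w) (hw_one : ∫⁻ x, w x ∂μ = 1)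
    {a b : S → X} (ha : Measurable a) (hb : Measurable b)
    (ha_smul : ∀ (z : X) s, a (z • s) = z * a s) (hb_smul : ∀ (z : X) s, b (z • s) = z * b s)
    {k : S → ℝ≥0∞} (hk : Measurable k) (hk_smul : ∀ (z : X) s, k (z • s) = k s) :
    ∫⁻ s, w (a s) * k s ∂M = ∫⁻ s, w (b s) * k s ∂M := by
  have lintegral_mul_right (x : X) : ∫⁻ z, w (z * x) ∂μ = 1 := by
    rw [lintegral_mul_right_eq_self, hw_one]
  have lintegral_inv_mul (x : X) : ∫⁻ z, w (z⁻¹ * x) ∂μ = 1 := by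
    rw [lintegral_inv_eq_self (μ := μ) fun z => w (z * x), lintegral_mul_right]
  calc ∫⁻ s, w (a s) * k s ∂M
      = ∫⁻ s, ∫⁻ z, w (a s) * w (z * b s) * k s ∂μ ∂M := by
        refine lintegral_congr fun s => ?_
        rw [lintegral_mul_const _ (by fun_prop), lintegral_const_mul _ (by fun_prop),
          lintegral_mul_right, mul_one]
    _ = ∫⁻ z, ∫⁻ s, w (a s) * w (z * b s) * k s ∂M ∂μ :=
        lintegral_lintegral_swap (by fun_prop)
    _ = ∫⁻ z, ∫⁻ s, w (z⁻¹ * a s) * w (b s) * k s ∂M ∂μ := by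
        refine lintegral_congr fun z => ?_
        rw [← (measurePreserving_smul z M).lintegral_comp
          (f := fun s => w (z⁻¹ * a s) * w (b s) * k s) (by fun_prop)]
        simp only [ha_smul, hb_smul, hk_smul, inv_mul_cancel_left]
    _ = ∫⁻ s, ∫⁻ z, w (z⁻¹ * a s) * w (b s) * k s ∂μ ∂M :=
        lintegral_lintegral_swap (by fun_prop)
    _ = ∫⁻ s, w (b s) * k s ∂M := by
        refine lintegral_congr fun s => ?_
        rw [lintegral_mul_const _ (by fun_prop), lintegral_mul_const _ (by fun_prop),
          lintegral_inv_mul, one_mul]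

instance {S T : Type*} [SMul X S] [SMul X T] [MeasurableSpace S] [MeasurableSpace T]
    [MeasurableConstSMul X S] [MeasurableConstSMul X T] : MeasurableConstSMul X (S × T) :=
  ⟨fun z => (measurable_fst.const_smul z).prodMk (measurable_snd.const_smul z)⟩

variable {Ω S : Type*} [MeasurableSpace Ω] [MeasurableSpace S] [MulAction X Ω] [MulAction X S]

theorem smulInvariantMeasure_compProd [MeasurableConstSMul X Ω] [MeasurableConstSMul X S]
    {P : Measure Ω} [SFinite P] [SMulInvariantMeasure X Ω P]
    {κ : Kernel Ω S} [IsSFiniteKernel κ]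
    (hκ : ∀ (z : X) ω, κ (z • ω) = (κ ω).map fun s => z • s) :
    SMulInvariantMeasure X (Ω × S) (P ⊗ₘ κ) := by
  refine ⟨fun z A hA => ?_⟩
  have hA' : MeasurableSet ((fun p : Ω × S => z • p) ⁻¹' A) := measurable_const_smul z hA
  rw [Measure.compProd_apply hA, Measure.compProd_apply hA',
    ← (measurePreserving_smul z P).lintegral_comp (Kernel.measurable_kernel_prodMk_left hA)]
  refine lintegral_congr fun ω => ?_
  rw [hκ, Measure.map_apply (measurable_const_smul z) (measurable_prodMk_left hA)]
  rfl

theorem prod_smul_eq_map [MeasurableConstSMul X S] {κ η : Kernel Ω S} [IsSFiniteKernel κ]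
    [IsSFiniteKernel η]
    (hκ : ∀ (z : X) ω, κ (z • ω) = (κ ω).map fun s => z • s)
    (hη : ∀ (z : X) ω, η (z • ω) = (η ω).map fun s => z • s) (z : X) (ω : Ω) :
    (κ ×ₖ η) (z • ω) = ((κ ×ₖ η) ω).map fun p => z • p := by
  rw [Kernel.prod_apply, Kernel.prod_apply, hκ, hη,
    Measure.map_prod_map _ _ (measurable_const_smul z) (measurable_const_smul z)]
  rfl

end MassTransport

section Atoms

variable {X : Type*} [TopologicalSpace X] [SecondCountableTopology X] [MeasurableSpace X]
  [BorelSpace X]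

theorem countable_points [T1Space X] (μ : CountingMeasure X) : (points μ).Countable := by
  have : IsLocallyFiniteMeasure (μ : Measure X) := μ.2.1
  exact (Measure.countable_meas_pos_of_disjoint_iUnion (μ := (μ : Measure X))
    (As := fun x : X => {x}) (fun x => measurableSet_singleton x)
    (fun _ _ hxy => disjoint_singleton.2 hxy)).mono fun _ hx => pos_iff_ne_zero.2 hx

variable [LocallyCompactSpace X] [T2Space X]

theorem measure_ne_zero_iff_exists_mem_points (μ : CountingMeasure X) {S : Set X} :
    (μ : Measure X) S ≠ 0 ↔ ∃ x ∈ points μ, x ∈ S := by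
  refine ⟨fun h => ?_, fun ⟨x, hx, hxS⟩ h0 =>
    hx (measure_mono_null (singleton_subset_iff.2 hxS) h0)⟩
  by_contra! h_disjoint
  have : IsLocallyFiniteMeasure (μ : Measure X) := μ.2.1
  refine h (measure_null_of_locally_null S fun x hxS => ?_)
  have hx_zero : (μ : Measure X) {x} = 0 := not_not.1 fun h0 => h_disjoint x h0 hxS
  obtain ⟨U, hxU, hU_open, hU⟩ :=
    Set.exists_isOpen_lt_of_lt {x} 1 (hx_zero.trans_lt zero_lt_one)
  refine ⟨U, mem_nhdsWithin_of_mem_nhds (hU_open.mem_nhds (hxU rfl)), ?_⟩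
  -- `μ U` is an integer smaller than one.
  obtain ⟨n, hn⟩ := μ.2.2 U hU_open.measurableSet
  rw [hn] at hU ⊢
  have hn_lt : n < 1 := by exact_mod_cast hU
  rw [Order.lt_one_iff.1 hn_lt, ENat.toENNReal_zero]

theorem ae_mem_points (μ : CountingMeasure X) : ∀ᵐ x ∂(μ : Measure X), x ∈ points μ := by
  by_contra h
  obtain ⟨x, hx, hx'⟩ := (measure_ne_zero_iff_exists_mem_points μ).1 h
  exact hx' hx

theorem IsSimple.lintegral_eq_tsum {μ : CountingMeasure X} (h : IsSimple μ) (f : X → ℝ≥0∞) :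
    ∫⁻ x, f x ∂(μ : Measure X) = ∑' x : points μ, f x := by
  rw [← Measure.restrict_eq_self_of_ae_mem (ae_mem_points μ),
    lintegral_countable f (countable_points μ)]
  exact tsum_congr fun x => by rw [h x x.2, mul_one]

theorem IsSimple.eq_sum_dirac {μ : CountingMeasure X} (h : IsSimple μ) :
    (μ : Measure X) = Measure.sum fun x : points μ => Measure.dirac (x : X) := by
  refine Measure.ext_of_lintegral _ fun f hf => ?_
  rw [h.lintegral_eq_tsum, lintegral_sum_measure]
  exact tsum_congr fun x => (lintegral_dirac' (x : X) hf).symm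

end Atoms

section FlowAdapted

variable {X : Type u} [Group X] [TopologicalSpace X] [MeasurableSpace X] {Ω : Type v}
  [MulAction X Ω] {m : Ω → CountingMeasure X}

theorem FlowAdapted.mul_mem_points_smul [MeasurableSingletonClass X] [MeasurableMul X]
    (hfa : FlowAdapted m) (z : X) (ω : Ω) (x : X) :
    z * x ∈ points (m (z • ω)) ↔ x ∈ points (m ω) := by
  have h_preimage : (fun y => z * y) ⁻¹' {z * x} = {x} := by
    ext y
    simp only [mem_preimage, mem_singleton_iff, mul_right_inj]
  rw [points, points, mem_ofPred_eq, mem_ofPred_eq, hfa z ω, leftTranslate,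
    Measure.map_apply (measurable_const_mul z) (measurableSet_singleton _), h_preimage]

theorem FlowAdapted.one_mem_points_inv_smul [MeasurableSingletonClass X] [MeasurableMul X]
    (hfa : FlowAdapted m) {ω : Ω} {x : X} :
    (1 : X) ∈ points (m (x⁻¹ • ω)) ↔ x ∈ points (m ω) := by
  rw [← hfa.mul_mem_points_smul x⁻¹ ω x, inv_mul_cancel]

end FlowAdapted

theorem intensity_ne_top {X : Type u} [Group X] [TopologicalSpace X] [LocallyCompactSpace X]
    [MeasurableSpace X] {Ω : Type v} [MeasurableSpace Ω] {m : Ω → CountingMeasure X}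
    {P : Measure Ω} {μ : Measure X} [μ.IsHaarMeasure]
    [IsLocallyFiniteMeasure (meanMeasure P m)] : intensity P μ m ≠ ∞ := by
  set K := Classical.arbitrary (TopologicalSpace.PositiveCompacts X)
  exact (ENNReal.div_lt_top K.isCompact.measure_lt_top.ne
    (Measure.measure_pos_of_nonempty_interior μ K.interior_nonempty).ne').ne

section PointProcess

open ProbabilityTheory

variable {X : Type u} [Group X] [TopologicalSpace X] [IsTopologicalGroup X]
  [LocallyCompactSpace X] [SecondCountableTopology X] [T2Space X]
  [MeasurableSpace X] [BorelSpace X]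
  {Ω : Type v} [MeasurableSpace Ω] {m : Ω → CountingMeasure X}

/-- A point process as a kernel. -/
def pointKernel (hm : Measurable m) : Kernel Ω X :=
  ⟨fun ω => (m ω : Measure X), measurable_coe_measure hm⟩

instance (hm : Measurable m) : IsSFiniteKernel (pointKernel hm) :=
  isSFiniteKernel_pointProcess hm

theorem measurable_lintegral_pointProcess (hm : Measurable m) {f : Ω × X → ℝ≥0∞}
    (hf : Measurable f) : Measurable fun ω => ∫⁻ x, f (ω, x) ∂(m ω : Measure X) :=
  hf.lintegral_kernel_prod_right' (κ := pointKernel hm)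

theorem measurableSet_exists_mem_points (hm : Measurable m) {T : Set (Ω × X)}
    (hT : MeasurableSet T) : MeasurableSet {ω | ∃ x ∈ points (m ω), (ω, x) ∈ T} := by
  have h : {ω | ∃ x ∈ points (m ω), (ω, x) ∈ T} =
      {ω | pointKernel hm ω (Prod.mk ω ⁻¹' T) ≠ 0} := by
    ext ω
    exact (measure_ne_zero_iff_exists_mem_points (m ω)).symm
  rw [h]
  exact ((Kernel.measurable_kernel_prodMk_left hT) (measurableSet_singleton 0)).compl

theorem measurableSet_mem_points (hm : Measurable m) {r : Ω → X} (hr : Measurable r) :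
    MeasurableSet {ω | r ω ∈ points (m ω)} := by
  have h := measurableSet_exists_mem_points hm (T := {p | p.2 = r p.1})
    (measurableSet_eq_fun measurable_snd (hr.comp measurable_fst))
  simpa only [mem_ofPred_eq, exists_eq_right] using h

variable [MulAction X Ω] {P : Measure Ω} [SMulInvariantMeasure X Ω P] {μ : Measure X}

theorem isMulLeftInvariant_meanMeasure [MeasurableConstSMul X Ω] (hm : Measurable m)
    (hfa : FlowAdapted m) : (meanMeasure P m).IsMulLeftInvariant := by
  refine ⟨fun x => Measure.ext fun B hB => ?_⟩
  have hB_meas : Measurable fun ω => (m ω : Measure X) B :=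
    (Measure.measurable_coe hB).comp (measurable_coe_measure hm)
  rw [Measure.map_apply (measurable_const_mul x) hB,
    meanMeasure_apply hm (measurable_const_mul x hB), meanMeasure_apply hm hB,
    ← (measurePreserving_smul x P).lintegral_comp hB_meas]
  refine lintegral_congr fun ω => ?_
  rw [hfa x ω, leftTranslate, Measure.map_apply (measurable_const_mul x) hB]

theorem smulInvariantMeasure_compProd_pointKernel_prod [MeasurableConstSMul X Ω] [SFinite P]
    (hm : Measurable m) (hfa : FlowAdapted m) :
    SMulInvariantMeasure X (Ω × X × X) (P ⊗ₘ (pointKernel hm ×ₖ pointKernel hm)) :=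
  smulInvariantMeasure_compProd (prod_smul_eq_map hfa hfa)

section Intensity

variable [MeasurableConstSMul X Ω] [μ.IsHaarMeasure] [IsLocallyFiniteMeasure (meanMeasure P m)]

theorem meanMeasure_eq_intensity_smul (hm : Measurable m) (hfa : FlowAdapted m) :
    meanMeasure P m = intensity P μ m • μ := by
  have := isMulLeftInvariant_meanMeasure (P := P) hm hfa
  have h_mean := Measure.isMulLeftInvariant_eq_smul (meanMeasure P m) μ
  set c := Measure.haarScalarFactor (meanMeasure P m) μ
  set K := Classical.arbitrary (TopologicalSpace.PositiveCompacts X) with hK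
  have h_intensity : intensity P μ m = c := by
    rw [intensity, h_mean, Measure.smul_apply, ENNReal.smul_def, smul_eq_mul, ← hK]
    exact ENNReal.mul_div_cancel_right
      (Measure.measure_pos_of_nonempty_interior μ K.interior_nonempty).ne'
      K.isCompact.measure_lt_top.ne
  rw [h_intensity]
  exact h_mean

theorem intensity_ne_zero (hm : Measurable m) (hfa : FlowAdapted m) (h0 : meanMeasure P m ≠ 0) :
    intensity P μ m ≠ 0 := by
  intro h
  rw [meanMeasure_eq_intensity_smul (μ := μ) hm hfa, h, zero_smul] at h0
  exact h0 rfl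

end Intensity

end PointProcess

/-! ## Palm measures -/

section Palm

open ProbabilityTheory

variable {X : Type u} [Group X] [TopologicalSpace X] [IsTopologicalGroup X]
  [LocallyCompactSpace X] [SecondCountableTopology X] [T2Space X]
  [MeasurableSpace X] [BorelSpace X]
  {Ω : Type v} [MeasurableSpace Ω] {P : Measure Ω} {μ : Measure X}
  {m : Ω → CountingMeasure X} {w : X → ℝ≥0}

theorem lintegral_compProd_pointKernel_prod_swap [SFinite P] (hm : Measurable m)
    {f : Ω × X × X → ℝ≥0∞} (hf : Measurable f) :
    ∫⁻ p, f (p.1, p.2.swap) ∂(P ⊗ₘ (pointKernel hm ×ₖ pointKernel hm)) =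
      ∫⁻ p, f p ∂(P ⊗ₘ (pointKernel hm ×ₖ pointKernel hm)) := by
  rw [Measure.lintegral_compProd (by fun_prop), Measure.lintegral_compProd hf]
  refine lintegral_congr fun ω => ?_
  rw [Kernel.prod_apply]
  exact (Measure.measurePreserving_swap (μ := pointKernel hm ω)
    (ν := pointKernel hm ω)).lintegral_comp (hf.comp measurable_prodMk_left)

variable [MulAction X Ω] [MeasurableSMul₂ X Ω]

theorem ae_palm_of_ae_forall_mem_points (hm : Measurable m) (hw : Measurable w) {A : Set Ω}
    (hA : MeasurableSet A) (h : ∀ᵐ ω ∂P, ∀ x ∈ points (m ω), x⁻¹ • ω ∈ A) :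
    ∀ᵐ ω ∂(palm P μ m w), ω ∈ A := by
  change palm P μ m w Aᶜ = 0
  have h_zero : ∀ᵐ ω ∂P,
      ∫⁻ x, Aᶜ.indicator (fun _ => (w x : ℝ≥0∞)) (x⁻¹ • ω) ∂(m ω : Measure X) = 0 := by
    filter_upwards [h] with ω hω
    refine (lintegral_congr_ae ?_).trans lintegral_zero
    filter_upwards [ae_mem_points (m ω)] with x hx
    exact indicator_of_notMem (notMem_compl_iff.2 (hω x hx)) _
  rw [palm_apply hm hw hA.compl, lintegral_congr_ae h_zero, lintegral_zero, mul_zero]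

variable [SFinite P]

theorem palm_eq_map (hm : Measurable m) (hw : Measurable w) :
    palm P μ m w = (intensity P μ m)⁻¹ •
      ((P ⊗ₘ pointKernel hm).withDensity fun p => (w p.2 : ℝ≥0∞)).map fun p => p.2⁻¹ • p.1 := by
  have h_smul : Measurable fun p : Ω × X => p.2⁻¹ • p.1 := by fun_prop
  ext A hA
  rw [palm_apply hm hw hA, Measure.smul_apply, smul_eq_mul, Measure.map_apply h_smul hA,
    withDensity_apply _ (h_smul hA), ← lintegral_indicator (h_smul hA),
    Measure.lintegral_compProd (Measurable.indicator (by fun_prop) (h_smul hA))]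
  rfl

theorem lintegral_palm (hm : Measurable m) (hw : Measurable w) {f : Ω → ℝ≥0∞}
    (hf : Measurable f) :
    ∫⁻ ω, f ω ∂(palm P μ m w) = (intensity P μ m)⁻¹ *
      ∫⁻ ω, ∫⁻ x, w x * f (x⁻¹ • ω) ∂(m ω : Measure X) ∂P := by
  have hf_smul : Measurable fun p : Ω × X => f (p.2⁻¹ • p.1) := by fun_prop
  have hw_snd : Measurable fun p : Ω × X => (w p.2 : ℝ≥0∞) := by fun_prop
  rw [palm_eq_map hm hw, lintegral_smul_measure, smul_eq_mul, lintegral_map hf (by fun_prop),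
    lintegral_withDensity_eq_lintegral_mul _ hw_snd hf_smul,
    Measure.lintegral_compProd (hw_snd.mul hf_smul)]
  rfl

theorem lintegral_palm_lintegral_points (hm : Measurable m) (hfa : FlowAdapted m)
    (hw : Measurable w) {f : Ω × X → ℝ≥0∞} (hf : Measurable f) :
    ∫⁻ ω, ∫⁻ y, f (ω, y) ∂(m ω : Measure X) ∂(palm P μ m w) = (intensity P μ m)⁻¹ *
      ∫⁻ p, w p.2.1 * f (p.2.1⁻¹ • p.1, p.2.1⁻¹ * p.2.2)
        ∂(P ⊗ₘ (pointKernel hm ×ₖ pointKernel hm)) := by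
  rw [lintegral_palm hm hw (measurable_lintegral_pointProcess hm hf),
    Measure.lintegral_compProd (by fun_prop)]
  congr 1
  refine lintegral_congr fun ω => ?_
  rw [Kernel.prod_apply, lintegral_prod _ (by fun_prop)]
  refine lintegral_congr fun x => ?_
  rw [hfa x⁻¹ ω, leftTranslate, lintegral_map (by fun_prop) (by fun_prop)]
  exact (lintegral_const_mul _ (by fun_prop)).symm

variable [SMulInvariantMeasure X Ω P] [μ.IsHaarMeasure]

theorem isProbabilityMeasure_palm [IsLocallyFiniteMeasure (meanMeasure P m)] (hm : Measurable m)
    (hfa : FlowAdapted m) (h0 : meanMeasure P m ≠ 0) (hw : Measurable w)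
    (hw_one : ∫⁻ x, (w x : ℝ≥0∞) ∂μ = 1) : IsProbabilityMeasure (palm P μ m w) := by
  have h_campbell : ∫⁻ ω, ∫⁻ x, w x ∂(m ω : Measure X) ∂P = intensity P μ m := by
    rw [← Measure.lintegral_bind (measurable_coe_measure hm).aemeasurable
      hw.coe_nnreal_ennreal.aemeasurable]
    change ∫⁻ x, w x ∂(meanMeasure P m) = _
    rw [meanMeasure_eq_intensity_smul (μ := μ) hm hfa, lintegral_smul_measure, hw_one,
      smul_eq_mul, mul_one]
  refine ⟨?_⟩
  rw [← lintegral_one, lintegral_palm hm hw measurable_const]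
  simp only [mul_one]
  rw [h_campbell, ENNReal.inv_mul_cancel (intensity_ne_zero hm hfa h0) intensity_ne_top]

/-- Both sides are integrals of the diagonally invariant `f (x⁻¹ • ω, x⁻¹ * y)` over pairs of
points, weighted by `w x` and by `w y` respectively. -/
theorem palm_exchange [μ.IsMulRightInvariant] (hm : Measurable m) (hfa : FlowAdapted m)
    (hw : Measurable w) (hw_one : ∫⁻ x, (w x : ℝ≥0∞) ∂μ = 1) {f : Ω × X → ℝ≥0∞}
    (hf : Measurable f) :
    ∫⁻ ω, ∫⁻ y, f (ω, y) ∂(m ω : Measure X) ∂(palm P μ m w) =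
      ∫⁻ ω, ∫⁻ y, f (y⁻¹ • ω, y⁻¹) ∂(m ω : Measure X) ∂(palm P μ m w) := by
  have := isInvInvariant_of_isMulRightInvariant μ
  have := smulInvariantMeasure_compProd_pointKernel_prod (P := P) hm hfa
  rw [lintegral_palm_lintegral_points hm hfa hw hf,
    lintegral_palm_lintegral_points hm hfa hw (f := fun p => f (p.2⁻¹ • p.1, p.2⁻¹))
      (by fun_prop), ← lintegral_compProd_pointKernel_prod_swap hm (by fun_prop)]
  simp only [mul_inv_rev, inv_inv, mul_smul, smul_inv_smul, Prod.fst_swap, Prod.snd_swap]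
  refine congrArg _ (lintegral_weight_swap (μ := μ) (w := fun x => (w x : ℝ≥0∞))
    (a := fun p : Ω × X × X => p.2.2) (b := fun p => p.2.1)
    (k := fun p => f (p.2.2⁻¹ • p.1, p.2.2⁻¹ * p.2.1)) (by fun_prop) hw_one
    (by fun_prop) (by fun_prop) (fun _ _ => rfl) (fun _ _ => rfl) (by fun_prop) ?_)
  intro z p
  simp only [Prod.smul_fst, Prod.smul_snd, smul_eq_mul, mul_inv_rev, mul_smul, inv_smul_smul,
    mul_assoc, inv_mul_cancel_left]

end Palm

/-! ## Balls and the local topology -/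

section Graph

variable {V W : Type*} {G : SimpleGraph V} {H : SimpleGraph W} {s : Set V} {t : Set W}

theorem dist_le_of_induce_iso (hG : G.Connected) (φ : G.induce s ≃g H.induce t) {n : ℕ}
    {a b : s} (hs : {x | G.dist a x ≤ n} ⊆ s) (hab : G.dist a b ≤ n) :
    H.dist (φ a : W) (φ b) ≤ n := by
  classical
  obtain ⟨p, hp⟩ := hG.exists_walk_length_eq_dist (a : V) b
  have h_support : ∀ x ∈ p.support, x ∈ s := fun x hx => hs <|
    ((SimpleGraph.dist_le (p.takeUntil x hx)).trans (p.length_takeUntil_le_length hx)).trans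
      (hp.trans_le hab)
  have h_length : (p.induce s h_support).length = p.length :=
    (SimpleGraph.Walk.length_map (SimpleGraph.Embedding.induce s).toHom _).symm.trans
      (congrArg SimpleGraph.Walk.length (SimpleGraph.Walk.map_induce p h_support))
  have h_dist := SimpleGraph.dist_le
    (((p.induce s h_support).map φ.toHom).map (SimpleGraph.Embedding.induce t).toHom)
  rw [SimpleGraph.Walk.length_map, SimpleGraph.Walk.length_map, h_length, hp] at h_dist
  exact h_dist.trans hab

theorem dist_le_iff_of_induce_iso (hG : G.Connected) (hH : H.Connected)
    (φ : G.induce s ≃g H.induce t) {n : ℕ} {a b : s} (hs : {x | G.dist a x ≤ n} ⊆ s)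
    (ht : {x | H.dist (φ a : W) x ≤ n} ⊆ t) :
    G.dist a b ≤ n ↔ H.dist (φ a : W) (φ b) ≤ n := by
  refine ⟨dist_le_of_induce_iso hG φ hs, fun h => ?_⟩
  have := dist_le_of_induce_iso hH φ.symm ht h
  rwa [RelIso.symm_apply_apply, RelIso.symm_apply_apply] at this

theorem dist_le_dist_of_iso (hG : G.Connected) (φ : G ≃g H) (a b : V) :
    H.dist (φ a) (φ b) ≤ G.dist a b := by
  obtain ⟨p, hp⟩ := hG.exists_walk_length_eq_dist a b
  exact (SimpleGraph.dist_le (p.map φ.toHom)).trans_eq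
    ((SimpleGraph.Walk.length_map φ.toHom p).trans hp)

theorem dist_eq_dist_of_iso (hG : G.Connected) (hH : H.Connected) (φ : G ≃g H) (a b : V) :
    H.dist (φ a) (φ b) = G.dist a b := by
  refine (dist_le_dist_of_iso hG φ a b).antisymm ?_
  have := dist_le_dist_of_iso hH φ.symm (φ a) (φ b)
  rwa [RelIso.symm_apply_apply, RelIso.symm_apply_apply] at this

theorem finite_setOf_dist_le (hG : G.Connected) (hf : ∀ v, (G.neighborSet v).Finite) (o : V)
    (n : ℕ) : {v | G.dist o v ≤ n}.Finite := by
  induction n with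
  | zero =>
    exact (finite_singleton o).subset fun v hv => (hG.dist_eq_zero_iff.1 (Nat.le_zero.1 hv)).symm
  | succ n ih =>
    refine (ih.union (ih.biUnion fun v _ => hf v)).subset fun v hv => ?_
    obtain ⟨p, hp⟩ := hG.exists_walk_length_eq_dist v o
    cases p with
    | nil => exact Or.inl ((SimpleGraph.dist_self).trans_le (Nat.zero_le n))
    | cons h q =>
      refine Or.inr (mem_biUnion (x := _) ?_ h.symm)
      have hq := SimpleGraph.dist_le q.reverse
      have hv' : G.dist o v ≤ n + 1 := hv
      rw [SimpleGraph.dist_comm, ← hp, SimpleGraph.Walk.length_cons] at hv'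
      rw [SimpleGraph.Walk.length_reverse] at hq
      exact hq.trans (by omega)

end Graph

section Ball

variable {Ξ : Type u} {k : ℕ}

theorem PointedNetwork.root_mem_ball (A : PointedNetwork Ξ k) (r : ℝ) (i : Fin k) :
    A.root i ∈ A.ball r :=
  ⟨i, SimpleGraph.dist_self.trans_le (Nat.zero_le _)⟩

theorem PointedNetwork.eventually_mem_ball (A : PointedNetwork Ξ k) (i : Fin k) (v : A.V) :
    ∀ᶠ r in atTop, v ∈ A.ball r := by
  filter_upwards [eventually_ge_atTop (A.graph.dist (A.root i) v : ℝ)] with r hr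
  exact ⟨i, by exact_mod_cast hr.trans (Nat.le_ceil r)⟩

theorem PointedNetwork.mem_ball_singleton {G : Network Ξ} {o v : G.V} {r : ℝ} :
    v ∈ (PointedNetwork.mk G ![o]).ball r ↔ G.graph.dist o v ≤ ⌈r⌉₊ :=
  Fin.exists_fin_one

theorem PointedNetwork.mem_ball_pair {G : Network Ξ} {o v x : G.V} {r : ℝ} :
    x ∈ (PointedNetwork.mk G ![o, v]).ball r ↔
      G.graph.dist o x ≤ ⌈r⌉₊ ∨ G.graph.dist v x ≤ ⌈r⌉₊ :=
  Fin.exists_fin_two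

theorem PointedNetwork.ball_pair_sub_subset {G : Network Ξ} {o v : G.V} {r : ℝ} {d : ℕ}
    (hv : G.graph.dist o v ≤ d) (hd : d ≤ ⌈r⌉₊) :
    (PointedNetwork.mk G ![o, v]).ball (r - d) ⊆ (PointedNetwork.mk G ![o]).ball r := by
  intro x hx
  rw [mem_ball_pair, Nat.ceil_sub_natCast] at hx
  have h_triangle := G.connected.dist_triangle (u := o) (v := v) (w := x)
  rw [mem_ball_singleton]
  omega

end Ball

section NearIso

variable {Ξ : Type u} [MetricSpace Ξ] {k l : ℕ}

/-- An isomorphism between the subgraphs induced on the vertex sets `s` of `G` and `t` of `H` which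
moves all marks by at most `ε`; for balls around the distinguished vertices and `ε = 1 / r` this is
what `PointedNetwork.Close` asks for. -/
structure NearIso (G H : Network Ξ) (s : Set G.V) (t : Set H.V) (ε : ℝ) where
  toIso : G.graph.induce s ≃g H.graph.induce t
  dist_vertexMark_le : ∀ v : s, dist (G.vertexMark v) (H.vertexMark (toIso v)) ≤ ε
  dist_edgeMark_le : ∀ v w : s, G.graph.Adj v w →
    dist (G.edgeMark v w) (H.edgeMark (toIso v) (toIso w)) ≤ ε

/-- The restriction of a near isomorphism to smaller vertex sets, with a larger tolerance. -/
def NearIso.restrict {G H : Network Ξ} {s s' : Set G.V} {t t' : Set H.V} {ε ε' : ℝ}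
    (φ : NearIso G H s t ε) (hs : s' ⊆ s) (ht : t' ⊆ t)
    (h_iff : ∀ x : s, (x : G.V) ∈ s' ↔ (φ.toIso x : H.V) ∈ t') (hε : ε ≤ ε') :
    NearIso G H s' t' ε' where
  toIso :=
    { toFun := fun v => ⟨φ.toIso ⟨v, hs v.2⟩, (h_iff _).1 v.2⟩
      invFun := fun v => ⟨φ.toIso.symm ⟨v, ht v.2⟩, by
        rw [h_iff, RelIso.apply_symm_apply]; exact v.2⟩
      left_inv := fun v => Subtype.ext (by simp only [Subtype.coe_eta, RelIso.symm_apply_apply])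
      right_inv := fun v => Subtype.ext (by simp only [Subtype.coe_eta, RelIso.apply_symm_apply])
      map_rel_iff' := fun {v w} =>
        φ.toIso.map_rel_iff (a := ⟨v, hs v.2⟩) (b := ⟨w, hs w.2⟩) }
  dist_vertexMark_le := fun v => (φ.dist_vertexMark_le ⟨v, hs v.2⟩).trans hε
  dist_edgeMark_le := fun v w h =>
    (φ.dist_edgeMark_le ⟨v, hs v.2⟩ ⟨w, hs w.2⟩ h).trans hε

theorem PointedNetwork.close_iff {A B : PointedNetwork Ξ k} {r : ℝ} :
    A.Close r B ↔ ∃ φ : NearIso A.toNetwork B.toNetwork (A.ball r) (B.ball r) (1 / r),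
      ∀ i, (φ.toIso ⟨A.root i, A.root_mem_ball r i⟩ : B.V) = B.root i := by
  refine ⟨fun ⟨φ, h_root, hv, he⟩ => ⟨⟨φ, hv, he⟩, fun i => h_root i _ rfl⟩, ?_⟩
  rintro ⟨φ, h_root⟩
  refine ⟨φ.toIso, ?_, φ.dist_vertexMark_le, φ.dist_edgeMark_le⟩
  rintro i ⟨v, hv⟩ rfl
  exact h_root i

theorem NearIso.close {G H : Network Ξ} {s : Set G.V} {t : Set H.V} {ε r : ℝ}
    (φ : NearIso G H s t ε) (hε : ε ≤ 1 / r) {ρ : Fin l → G.V} {σ : Fin l → H.V}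
    (h_root : ∀ i, ∃ h : ρ i ∈ s, (φ.toIso ⟨ρ i, h⟩ : H.V) = σ i)
    (hs : (PointedNetwork.mk G ρ).ball r ⊆ s) (ht : (PointedNetwork.mk H σ).ball r ⊆ t) :
    (PointedNetwork.mk G ρ).Close r (PointedNetwork.mk H σ) := by
  refine PointedNetwork.close_iff.2 ⟨φ.restrict hs ht (fun x => exists_congr fun i => ?_) hε,
    fun i => (h_root i).2⟩
  obtain ⟨hρ, hσ⟩ := h_root i
  have hs_root : {x | G.graph.dist (ρ i) x ≤ ⌈r⌉₊} ⊆ s := fun x hx => hs ⟨i, hx⟩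
  have ht_root : {x | H.graph.dist (σ i) x ≤ ⌈r⌉₊} ⊆ t := fun x hx => ht ⟨i, hx⟩
  simp only [← hσ] at ht_root ⊢
  exact dist_le_iff_of_induce_iso G.connected H.connected φ.toIso (a := ⟨ρ i, hρ⟩) (b := x)
    hs_root ht_root

theorem NearIso.close_pair {G H : Network Ξ} {o v : G.V} {p : H.V} {r : ℝ}
    (φ : NearIso G H ((PointedNetwork.mk G ![o]).ball r) ((PointedNetwork.mk H ![p]).ball r)
      (1 / r))
    (h_root : (φ.toIso ⟨o, PointedNetwork.root_mem_ball _ r 0⟩ : H.V) = p)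
    (hv : v ∈ (PointedNetwork.mk G ![o]).ball r) (hr : G.graph.dist o v < r) :
    (PointedNetwork.mk G ![o, v]).Close (r - G.graph.dist o v)
      (PointedNetwork.mk H ![p, φ.toIso ⟨v, hv⟩]) := by
  have hd : G.graph.dist o v ≤ ⌈r⌉₊ := PointedNetwork.mem_ball_singleton.1 hv
  have h_dist : H.graph.dist p (φ.toIso ⟨v, hv⟩) ≤ G.graph.dist o v := by
    have h := dist_le_of_induce_iso (n := G.graph.dist o v) G.connected φ.toIso
      (a := ⟨o, PointedNetwork.root_mem_ball _ r 0⟩) (b := ⟨v, hv⟩)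
      (fun x hx => PointedNetwork.mem_ball_singleton.2 (le_trans hx hd)) le_rfl
    rwa [h_root] at h
  refine φ.close (one_div_le_one_div_of_le (sub_pos.2 hr) (sub_le_self _ (Nat.cast_nonneg _)))
    (Fin.forall_fin_two.2 ⟨⟨_, h_root⟩, ⟨hv, rfl⟩⟩)
    (PointedNetwork.ball_pair_sub_subset le_rfl hd)
    (PointedNetwork.ball_pair_sub_subset h_dist hd)

end NearIso

section MarkedIso

variable {Ξ : Type u} {k : ℕ}

/-- An isomorphism of networks preserving all marks, without regard to distinguished vertices. -/
structure MarkedIso (G H : Network Ξ) where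
  toIso : G.graph ≃g H.graph
  vertexMark_eq : ∀ v, G.vertexMark v = H.vertexMark (toIso v)
  edgeMark_eq : ∀ v w, G.graph.Adj v w → G.edgeMark v w = H.edgeMark (toIso v) (toIso w)

/-- The inverse of a mark preserving isomorphism. -/
def MarkedIso.symm {G H : Network Ξ} (φ : MarkedIso G H) : MarkedIso H G where
  toIso := φ.toIso.symm
  vertexMark_eq v := by rw [φ.vertexMark_eq, RelIso.apply_symm_apply]
  edgeMark_eq v w h := by
    rw [φ.edgeMark_eq _ _ (φ.toIso.symm.map_rel_iff.2 h), RelIso.apply_symm_apply,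
      RelIso.apply_symm_apply]

theorem PointedNetwork.isomorphic_iff {A B : PointedNetwork Ξ k} :
    A.Isomorphic B ↔
      ∃ φ : MarkedIso A.toNetwork B.toNetwork, ∀ i, φ.toIso (A.root i) = B.root i :=
  ⟨fun ⟨φ, hv, he, h_root⟩ => ⟨⟨φ, hv, he⟩, h_root⟩,
    fun ⟨φ, h_root⟩ => ⟨φ.toIso, φ.vertexMark_eq, φ.edgeMark_eq, h_root⟩⟩

theorem PointedNetwork.eq_mk_singleton (A : PointedNetwork Ξ 1) :
    A = PointedNetwork.mk A.toNetwork ![A.root 0] := by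
  obtain ⟨G, ρ⟩ := A
  exact congrArg _ (funext (Fin.forall_fin_one.2 rfl))

theorem PointedNetwork.eq_mk_pair (A : PointedNetwork Ξ 2) :
    A = PointedNetwork.mk A.toNetwork ![A.root 0, A.root 1] := by
  obtain ⟨G, ρ⟩ := A
  exact congrArg _ (funext (Fin.forall_fin_two.2 ⟨rfl, rfl⟩))

theorem exists_eq_rooted (a : NetworkClass Ξ 1) : ∃ (G : Network Ξ) (o : G.V), a = rooted G o := by
  induction a using Quotient.inductionOn with
  | h A => exact ⟨A.toNetwork, A.root 0, congrArg _ A.eq_mk_singleton⟩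

theorem exists_eq_birooted (a : NetworkClass Ξ 2) :
    ∃ (G : Network Ξ) (o v : G.V), a = birooted G o v := by
  induction a using Quotient.inductionOn with
  | h A => exact ⟨A.toNetwork, A.root 0, A.root 1, congrArg _ A.eq_mk_pair⟩

theorem exists_markedIso_of_rooted_eq {G H : Network Ξ} {o : G.V} {p : H.V}
    (h : rooted G o = rooted H p) : ∃ φ : MarkedIso G H, φ.toIso o = p :=
  (PointedNetwork.isomorphic_iff.1 (Quotient.exact h)).imp fun _ h_root => h_root 0

theorem MarkedIso.birooted_eq {G H : Network Ξ} (φ : MarkedIso G H) (v w : G.V) :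
    birooted G v w = birooted H (φ.toIso v) (φ.toIso w) :=
  PalmNetwork.birooted_eq (A := PointedNetwork.mk G ![v]) (B := PointedNetwork.mk H ![φ.toIso v])
    φ.toIso φ.vertexMark_eq φ.edgeMark_eq v w

/-- The map `[G, o, v] ↦ [G, o]`. -/
def forget : NetworkClass Ξ 2 → NetworkClass Ξ 1 :=
  Quotient.map (fun A => PointedNetwork.mk A.toNetwork ![A.root 0])
    fun _ _ ⟨φ, hv, he, h_root⟩ => ⟨φ, hv, he, Fin.forall_fin_one.2 (h_root 0)⟩

theorem forget_birooted (G : Network Ξ) (o v : G.V) : forget (birooted G o v) = rooted G o := rfl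

/-- The graph distance of the two distinguished vertices. -/
noncomputable def rootDist : NetworkClass Ξ 2 → ℕ :=
  Quotient.lift (fun A : PointedNetwork Ξ 2 => A.graph.dist (A.root 0) (A.root 1))
    fun A B ⟨φ, _, _, h_root⟩ => by
      rw [← h_root 0, ← h_root 1, dist_eq_dist_of_iso A.connected B.connected]

theorem massOut_rooted (g : NetworkClass Ξ 2 → ℝ≥0∞) (G : Network Ξ) (o : G.V) :
    massOut g (rooted G o) = ∑' v, g (birooted G o v) := rfl

theorem massIn_rooted (g : NetworkClass Ξ 2 → ℝ≥0∞) (G : Network Ξ) (o : G.V) :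
    massIn g (rooted G o) = ∑' v, g (birooted G v o) := rfl

end MarkedIso

section LocalTopology

variable {Ξ : Type u} [MetricSpace Ξ] {k : ℕ}

instance : BorelSpace (NetworkClass Ξ k) := ⟨rfl⟩

theorem NetworkClass.isOpen_iff {U : Set (NetworkClass Ξ k)} :
    IsOpen U ↔ ∀ A : PointedNetwork Ξ k, Quotient.mk _ A ∈ U →
      ∀ᶠ r in atTop, ∀ B : PointedNetwork Ξ k, A.Close r B → Quotient.mk _ B ∈ U := by
  refine forall_congr' fun A => imp_congr_right fun _ => ?_
  exact ((atTop_basis_Ioi' (0 : ℝ)).eventually_iff).symm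

theorem NetworkClass.isOpen_iff_rooted {U : Set (NetworkClass Ξ 1)} :
    IsOpen U ↔ ∀ (G : Network Ξ) (o : G.V), rooted G o ∈ U → ∀ᶠ r in atTop,
      ∀ (H : Network Ξ) (p : H.V),
        (PointedNetwork.mk G ![o]).Close r (PointedNetwork.mk H ![p]) → rooted H p ∈ U := by
  rw [NetworkClass.isOpen_iff]
  refine ⟨fun h G o ho => (h _ ho).mono fun r hr H p => hr _, fun h A hA => ?_⟩
  rw [A.eq_mk_singleton] at hA ⊢
  refine (h _ _ hA).mono fun r hr B hB => ?_
  rw [B.eq_mk_singleton] at hB ⊢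
  exact hr _ _ hB

theorem continuous_forget : Continuous (forget : NetworkClass Ξ 2 → NetworkClass Ξ 1) := by
  refine continuous_def.2 fun U hU => NetworkClass.isOpen_iff.2 fun A hA => ?_
  refine (NetworkClass.isOpen_iff.1 hU _ hA).mono fun r hr B hAB => hr _ ?_
  obtain ⟨φ, h_root⟩ := PointedNetwork.close_iff.1 hAB
  refine φ.close le_rfl (Fin.forall_fin_one.2 ⟨A.root_mem_ball r 0, h_root 0⟩) ?_ ?_ <;>
  exact fun x hx => ⟨0, PointedNetwork.mem_ball_singleton.1 hx⟩

theorem isOpen_setOf_rootDist_le (n : ℕ) :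
    IsOpen {b : NetworkClass Ξ 2 | rootDist b ≤ n} := by
  refine NetworkClass.isOpen_iff.2 fun A (hA : A.graph.dist (A.root 0) (A.root 1) ≤ n) => ?_
  filter_upwards [eventually_ge_atTop (n : ℝ)] with r hr B hAB
  obtain ⟨φ, h_root⟩ := PointedNetwork.close_iff.1 hAB
  have hn : n ≤ ⌈r⌉₊ := by exact_mod_cast hr.trans (Nat.le_ceil r)
  have h_dist := dist_le_of_induce_iso A.connected φ.toIso (n := n)
    (a := ⟨_, A.root_mem_ball r 0⟩) (b := ⟨_, A.root_mem_ball r 1⟩)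
    (fun x hx => ⟨0, le_trans hx hn⟩) hA
  rwa [h_root, h_root] at h_dist

theorem eventually_birooted_mem {U : Set (NetworkClass Ξ 2)} (hU : IsOpen U) {G : Network Ξ}
    {o v : G.V} (h : birooted G o v ∈ U) :
    ∀ᶠ r in atTop, ∀ (H : Network Ξ) (p : H.V)
      (φ : NearIso G H ((PointedNetwork.mk G ![o]).ball r) ((PointedNetwork.mk H ![p]).ball r)
        (1 / r)),
      (φ.toIso ⟨o, PointedNetwork.root_mem_ball _ r 0⟩ : H.V) = p →
      ∀ hv, birooted H p (φ.toIso ⟨v, hv⟩) ∈ U := by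
  have h_sub := tendsto_atTop_add_const_right atTop (-(G.graph.dist o v : ℝ)) tendsto_id
  filter_upwards [h_sub.eventually (NetworkClass.isOpen_iff.1 hU _ h),
    eventually_gt_atTop (G.graph.dist o v : ℝ)] with r hrU hr H p φ h_root hv
  exact hrU _ (φ.close_pair h_root hv hr)

theorem lowerSemicontinuous_massOut_indicator {U : Set (NetworkClass Ξ 2)} (hU : IsOpen U) :
    LowerSemicontinuous (massOut (U.indicator 1) : NetworkClass Ξ 1 → ℝ≥0∞) := by
  classical
  refine lowerSemicontinuous_iff_isOpen_preimage.2 fun c => ?_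
  refine NetworkClass.isOpen_iff_rooted.2 fun G o (ho : c < massOut _ (rooted G o)) => ?_
  rw [massOut_rooted, ENNReal.tsum_eq_iSup_sum, lt_iSup_iff] at ho
  obtain ⟨F, hF⟩ := ho
  have h_ball : ∀ᶠ r in atTop, ∀ v ∈ F, v ∈ (PointedNetwork.mk G ![o]).ball r :=
    F.eventually_all.2 fun v _ => PointedNetwork.eventually_mem_ball (PointedNetwork.mk G ![o]) 0 v
  have h_near := F.eventually_all.2 fun v _ =>
    eventually_imp_distrib_left.2 (eventually_birooted_mem hU (o := o) (v := v))
  filter_upwards [h_ball, h_near] with r hr_ball hr_near H p h_close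
  obtain ⟨φ, h_root⟩ := PointedNetwork.close_iff.1 h_close
  let toH (v : F) : H.V := φ.toIso ⟨v, hr_ball v v.2⟩
  have h_inj : Function.Injective toH := fun v w hvw =>
    Subtype.ext (Subtype.mk.inj (φ.toIso.injective (Subtype.ext hvw)))
  have h_le (v : F) : U.indicator (1 : NetworkClass Ξ 2 → ℝ≥0∞) (birooted G o v) ≤
      U.indicator 1 (birooted H p (toH v)) := by
    refine indicator_apply_le' (fun hv => ?_) fun _ => zero_le
    rw [indicator_of_mem (hr_near v v.2 hv H p φ (h_root 0) _)]
    rfl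
  calc c < ∑ v ∈ F, U.indicator 1 (birooted G o v) := hF
    _ = ∑' v : F, U.indicator 1 (birooted G o v) := by rw [← Finset.sum_coe_sort, tsum_fintype]
    _ ≤ ∑' v : F, U.indicator 1 (birooted H p (toH v)) := ENNReal.tsum_le_tsum h_le
    _ ≤ ∑' v : H.V, U.indicator 1 (birooted H p v) :=
      ENNReal.tsum_comp_le_tsum_of_injective h_inj _

end LocalTopology

section VertexMeasure

variable {Ξ : Type u} [MetricSpace Ξ]

/-- The sum of the Dirac measures at `[G, o, v]` over the vertices `v` of `G`, as a function of
`[G, o]`; the representative chosen by `Quotient.out` is immaterial. -/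
noncomputable def vertexMeasure (a : NetworkClass Ξ 1) : Measure (NetworkClass Ξ 2) :=
  Measure.sum fun v : (Quotient.out a).V =>
    Measure.dirac (birooted (Quotient.out a).toNetwork ((Quotient.out a).root 0) v)

theorem lintegral_vertexMeasure {g : NetworkClass Ξ 2 → ℝ≥0∞} (hg : Measurable g)
    (a : NetworkClass Ξ 1) : ∫⁻ b, g b ∂(vertexMeasure a) = massOut g a := by
  conv_rhs => rw [← Quotient.out_eq a]
  rw [vertexMeasure, lintegral_sum_measure]
  exact tsum_congr fun v => lintegral_dirac' _ hg

theorem vertexMeasure_apply {U : Set (NetworkClass Ξ 2)} (hU : MeasurableSet U)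
    (a : NetworkClass Ξ 1) : vertexMeasure a U = massOut (U.indicator 1) a := by
  rw [← lintegral_vertexMeasure (measurable_one.indicator hU), lintegral_indicator_one hU]

theorem measurable_vertexMeasure_apply_of_isOpen {U : Set (NetworkClass Ξ 2)} (hU : IsOpen U) :
    Measurable fun a : NetworkClass Ξ 1 => vertexMeasure a U := by
  simp only [vertexMeasure_apply hU.measurableSet]
  exact (lowerSemicontinuous_massOut_indicator hU).measurable

theorem vertexMeasure_rootDist_le_lt_top (a : NetworkClass Ξ 1) (n : ℕ) :
    vertexMeasure a {b | rootDist b ≤ n} < ∞ := by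
  obtain ⟨G, o, rfl⟩ := exists_eq_rooted a
  have h_indicator (v : G.V) :
      {b : NetworkClass Ξ 2 | rootDist b ≤ n}.indicator (1 : NetworkClass Ξ 2 → ℝ≥0∞)
        (birooted G o v) = {v | G.graph.dist o v ≤ n}.indicator (fun _ => 1) v := rfl
  rw [vertexMeasure_apply (isOpen_setOf_rootDist_le n).measurableSet, massOut_rooted,
    tsum_congr h_indicator, ← tsum_subtype, ENNReal.tsum_set_one, ← ENat.toENNReal_top]
  exact ENat.toENNReal_lt.2
    (finite_setOf_dist_le G.connected G.locallyFinite o n).encard_lt_top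

theorem measurable_vertexMeasure_restrict (n : ℕ) :
    Measurable fun a : NetworkClass Ξ 1 => (vertexMeasure a).restrict {b | rootDist b ≤ n} := by
  have (a : NetworkClass Ξ 1) :
      IsFiniteMeasure ((vertexMeasure a).restrict {b | rootDist b ≤ n}) :=
    ⟨by rw [Measure.restrict_apply_univ]; exact vertexMeasure_rootDist_le_lt_top a n⟩
  refine Measurable.measure_of_isPiSystem (S := {U | IsOpen U}) rfl isPiSystem_isOpen
    (fun U (hU : IsOpen U) => ?_) ?_
  · simp only [Measure.restrict_apply hU.measurableSet]
    exact measurable_vertexMeasure_apply_of_isOpen (hU.inter (isOpen_setOf_rootDist_le n))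
  · simp only [Measure.restrict_apply_univ]
    exact measurable_vertexMeasure_apply_of_isOpen (isOpen_setOf_rootDist_le n)

theorem measurable_vertexMeasure :
    Measurable (vertexMeasure : NetworkClass Ξ 1 → Measure (NetworkClass Ξ 2)) := by
  have h_mono : Monotone fun n : ℕ => {b : NetworkClass Ξ 2 | rootDist b ≤ n} :=
    fun _ _ hij _ hb => le_trans hb hij
  have h_iUnion : ⋃ n : ℕ, {b : NetworkClass Ξ 2 | rootDist b ≤ n} = univ :=
    iUnion_eq_univ_iff.2 fun b => ⟨rootDist b, le_refl (rootDist b)⟩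
  refine Measure.measurable_of_measurable_coe _ fun U hU => ?_
  have h_iSup (a : NetworkClass Ξ 1) : vertexMeasure a U =
      ⨆ n : ℕ, (vertexMeasure a).restrict {b | rootDist b ≤ n} U := by
    rw [← Measure.restrict_iUnion_apply_eq_iSup h_mono.directed_le hU, h_iUnion,
      Measure.restrict_univ]
  simp only [h_iSup]
  exact Measurable.iSup fun n =>
    (Measure.measurable_coe hU).comp (measurable_vertexMeasure_restrict n)

end VertexMeasure

/-! ## Products of edge marks along walks -/

section Transport

variable {X : Type*} [Group X] {Ξ : Type u} (c : Ξ → X)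

/-- The product of the group elements `c ξ` over the marks `ξ` of the edges along a walk. -/
def Network.walkProd (G : Network Ξ) : ∀ {u v : G.V}, G.graph.Walk u v → X
  | _, _, .nil => 1
  | u, _, .cons (v := w) _ p => c (G.edgeMark u w) * G.walkProd p

theorem Network.walkProd_append (G : Network Ξ) {u v w : G.V} (p : G.graph.Walk u v)
    (q : G.graph.Walk v w) :
    G.walkProd c (p.append q) = G.walkProd c p * G.walkProd c q := by
  induction p with
  | nil => exact (one_mul _).symm
  | cons h p ih => exact (congrArg _ (ih q)).trans (mul_assoc _ _ _).symm

theorem MarkedIso.walkProd_map {G H : Network Ξ} (φ : MarkedIso G H) {u v : G.V}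
    (p : G.graph.Walk u v) : H.walkProd c (p.map φ.toIso.toHom) = G.walkProd c p := by
  induction p with
  | nil => rfl
  | cons h p ih => exact congrArg₂ _ (congrArg c (φ.edgeMark_eq _ _ h).symm) ih

/-- The product along a walk depends only on its end points. -/
def Network.Consistent (G : Network Ξ) : Prop :=
  ∀ (u v : G.V) (p q : G.graph.Walk u v), G.walkProd c p = G.walkProd c q

open Classical in
/-- The product along any walk from `o` to `v` in a consistent network; the value is `1` in all
other networks. -/
noncomputable def Network.transport (G : Network Ξ) (o v : G.V) : X :=
  if G.Consistent c then G.walkProd c (G.connected.preconnected o v).some else 1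

variable {c}

theorem Network.Consistent.transport_eq {G : Network Ξ} (hG : G.Consistent c) {o v : G.V}
    (p : G.graph.Walk o v) : G.transport c o v = G.walkProd c p :=
  (if_pos hG).trans (hG _ _ _ _)

theorem Network.Consistent.transport_mul {G : Network Ξ} (hG : G.Consistent c) (o v w : G.V) :
    G.transport c o v * G.transport c v w = G.transport c o w := by
  obtain ⟨p⟩ := G.connected.preconnected o v
  obtain ⟨q⟩ := G.connected.preconnected v w
  rw [hG.transport_eq p, hG.transport_eq q, hG.transport_eq (p.append q), G.walkProd_append c]

theorem Network.Consistent.transport_self {G : Network Ξ} (hG : G.Consistent c) (o : G.V) :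
    G.transport c o o = 1 := hG.transport_eq .nil

theorem Network.Consistent.transport_symm {G : Network Ξ} (hG : G.Consistent c) (o v : G.V) :
    G.transport c v o = (G.transport c o v)⁻¹ :=
  eq_inv_of_mul_eq_one_left ((hG.transport_mul v o v).trans (hG.transport_self v))

theorem Network.Consistent.of_markedIso {G H : Network Ξ} (hH : H.Consistent c)
    (φ : MarkedIso G H) : G.Consistent c := by
  intro u v p q
  rw [← φ.walkProd_map c p, ← φ.walkProd_map c q]
  exact hH _ _ _ _

theorem MarkedIso.transport_eq {G H : Network Ξ} (φ : MarkedIso G H) (o v : G.V) :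
    G.transport c o v = H.transport c (φ.toIso o) (φ.toIso v) := by
  by_cases hG : G.Consistent c
  · obtain ⟨p⟩ := G.connected.preconnected o v
    rw [hG.transport_eq p, ← φ.walkProd_map c p]
    exact ((hG.of_markedIso φ.symm).transport_eq (p.map φ.toIso.toHom)).symm
  · rw [Network.transport, if_neg hG, Network.transport, if_neg fun h => hG (h.of_markedIso φ)]

variable (c)

/-- The classes of consistent networks. -/
def consistentClasses : Set (NetworkClass Ξ 1) :=
  {a | ∃ (G : Network Ξ) (o : G.V), a = rooted G o ∧ G.Consistent c}

/-- The transport from the first to the second distinguished vertex. -/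
noncomputable def transportClass : NetworkClass Ξ 2 → X :=
  Quotient.lift (fun A : PointedNetwork Ξ 2 => A.toNetwork.transport c (A.root 0) (A.root 1))
    fun A B h => by
      obtain ⟨φ, h_root⟩ := PointedNetwork.isomorphic_iff.1 h
      rw [φ.transport_eq, h_root, h_root]

variable {c}

theorem rooted_mem_consistentClasses {G : Network Ξ} {o : G.V} :
    rooted G o ∈ consistentClasses c ↔ G.Consistent c := by
  refine ⟨?_, fun h => ⟨G, o, rfl, h⟩⟩
  rintro ⟨H, p, h, hH⟩
  obtain ⟨φ, -⟩ := exists_markedIso_of_rooted_eq h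
  exact hH.of_markedIso φ

theorem transportClass_of_notMem {b : NetworkClass Ξ 2} (h : forget b ∉ consistentClasses c) :
    transportClass c b = 1 := by
  obtain ⟨G, o, v, rfl⟩ := exists_eq_birooted b
  exact if_neg (mt rooted_mem_consistentClasses.2 h)

end Transport

section TransportMeasurability

variable {X : Type*} [Group X] [TopologicalSpace X] {Ξ : Type u} [MetricSpace Ξ] {c : Ξ → X}
  {k : ℕ}

theorem eventually_exists_walkProd_mem [ContinuousMul X] (hc : Continuous c)
    (A : PointedNetwork Ξ k) (i : Fin k) {u v : A.V} (p : A.graph.Walk u v) :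
    ∀ {O : Set X}, O ∈ 𝓝 (A.toNetwork.walkProd c p) →
      ∀ᶠ r in atTop, ∀ (B : PointedNetwork Ξ k)
        (φ : NearIso A.toNetwork B.toNetwork (A.ball r) (B.ball r) (1 / r)),
        ∃ (hu : u ∈ A.ball r) (hv : v ∈ A.ball r)
          (q : B.graph.Walk (φ.toIso ⟨u, hu⟩ : B.V) (φ.toIso ⟨v, hv⟩)),
          B.toNetwork.walkProd c q ∈ O := by
  induction p with
  | @nil u =>
    intro O hO
    filter_upwards [A.eventually_mem_ball i u] with r hu B φ
    exact ⟨hu, hu, .nil, mem_of_mem_nhds hO⟩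
  | @cons u w v h p ih =>
    intro O hO
    have h_mul : Tendsto (fun z : X × X => z.1 * z.2)
        (𝓝 (c (A.edgeMark u w)) ×ˢ 𝓝 (A.toNetwork.walkProd c p))
        (𝓝 (A.toNetwork.walkProd c (.cons h p))) := by
      rw [← nhds_prod_eq]
      exact continuous_mul.tendsto _
    obtain ⟨O₁, hO₁, O₂, hO₂, h_sub⟩ := mem_prod_iff.1 (h_mul hO)
    obtain ⟨δ, hδ, h_ball⟩ := Metric.nhds_basis_closedBall.mem_iff.1
      (hc.continuousAt (x := A.edgeMark u w) hO₁)
    have h_small : ∀ᶠ r : ℝ in atTop, 1 / r < δ := by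
      simpa only [one_div] using tendsto_inv_atTop_zero.eventually_lt_const hδ
    filter_upwards [A.eventually_mem_ball i u, h_small, ih hO₂] with r hu hr h_walk B φ
    obtain ⟨hw, hv, q, hq⟩ := h_walk B φ
    have h_adj : B.graph.Adj (φ.toIso ⟨u, hu⟩) (φ.toIso ⟨w, hw⟩) :=
      φ.toIso.map_rel_iff.2 (show (A.graph.induce _).Adj ⟨u, hu⟩ ⟨w, hw⟩ from h)
    refine ⟨hu, hv, .cons h_adj q, h_sub (mk_mem_prod (h_ball ?_) hq)⟩
    rw [Metric.mem_closedBall, dist_comm]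
    exact (φ.dist_edgeMark_le ⟨u, hu⟩ ⟨w, hw⟩ h).trans hr.le

theorem isClosed_consistentClasses [ContinuousMul X] [T2Space X] (hc : Continuous c) :
    IsClosed (consistentClasses c : Set (NetworkClass Ξ 1)) := by
  refine ⟨NetworkClass.isOpen_iff_rooted.2 fun G o ho => ?_⟩
  rw [mem_compl_iff, rooted_mem_consistentClasses, Network.Consistent] at ho
  push Not at ho
  obtain ⟨u, v, p, q, hpq⟩ := ho
  obtain ⟨O₁, O₂, hO₁, hO₂, hp, hq, h_disj⟩ := t2_separation hpq
  let A := PointedNetwork.mk G ![o]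
  filter_upwards [eventually_exists_walkProd_mem hc A 0 p (hO₁.mem_nhds hp),
    eventually_exists_walkProd_mem hc A 0 q (hO₂.mem_nhds hq)] with r hr₁ hr₂ H s h_close hH
  obtain ⟨φ, -⟩ := PointedNetwork.close_iff.1 h_close
  obtain ⟨hu, hv, p', hp'⟩ := hr₁ _ φ
  obtain ⟨_, _, q', hq'⟩ := hr₂ _ φ
  refine h_disj.notMem_of_mem_left hp' ?_
  rwa [rooted_mem_consistentClasses.1 hH _ _ p' q']

theorem isOpen_compl_consistentClasses_union [ContinuousMul X] [T2Space X] (hc : Continuous c)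
    {O : Set X} (hO : IsOpen O) :
    IsOpen ((forget ⁻¹' consistentClasses c)ᶜ ∪ transportClass c ⁻¹' O :
      Set (NetworkClass Ξ 2)) := by
  refine NetworkClass.isOpen_iff.2 fun A hA => ?_
  by_cases hAc : A.toNetwork.Consistent c
  · have hAO : A.toNetwork.transport c (A.root 0) (A.root 1) ∈ O :=
      hA.resolve_left fun h => h (rooted_mem_consistentClasses.2 hAc)
    obtain ⟨p⟩ := A.connected.preconnected (A.root 0) (A.root 1)
    rw [hAc.transport_eq p] at hAO
    filter_upwards [eventually_exists_walkProd_mem hc A 0 p (hO.mem_nhds hAO)] with r hr B h_close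
    obtain ⟨φ, h_root⟩ := PointedNetwork.close_iff.1 h_close
    obtain ⟨_, _, q, hq⟩ := hr B φ
    refine or_iff_not_imp_left.2 fun hB => ?_
    have hBc := rooted_mem_consistentClasses.1 (not_not.1 hB)
    rw [← hBc.transport_eq q, h_root 0, h_root 1] at hq
    exact hq
  · have h_open := (isClosed_consistentClasses hc).preimage continuous_forget |>.isOpen_compl
    filter_upwards [NetworkClass.isOpen_iff.1 h_open A fun h =>
      hAc (rooted_mem_consistentClasses.1 h)] with r hr B h_close
    exact Or.inl (hr B h_close)

theorem continuousOn_transportClass [ContinuousMul X] [T2Space X] (hc : Continuous c) :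
    ContinuousOn (transportClass c : NetworkClass Ξ 2 → X) (forget ⁻¹' consistentClasses c) := by
  refine continuousOn_iff'.2 fun O hO => ⟨_, isOpen_compl_consistentClasses_union hc hO, ?_⟩
  rw [union_inter_distrib_right, compl_inter_self, empty_union]

theorem measurable_transportClass [ContinuousMul X] [T2Space X] [MeasurableSpace X] [BorelSpace X]
    (hc : Continuous c) : Measurable (transportClass c : NetworkClass Ξ 2 → X) := by
  classical
  have h_compl : ContinuousOn (transportClass c : NetworkClass Ξ 2 → X)
      (forget ⁻¹' consistentClasses c)ᶜ :=
    continuousOn_const.congr fun b hb => transportClass_of_notMem hb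
  rw [← piecewise_same (forget ⁻¹' consistentClasses c) (transportClass c)]
  exact (continuousOn_transportClass hc).measurable_piecewise h_compl
    ((isClosed_consistentClasses hc).preimage continuous_forget).measurableSet

end TransportMeasurability

section LeftTranslate

variable {X : Type*} [Group X] [MeasurableSpace X]

theorem leftTranslate_one (μ : Measure X) : leftTranslate 1 μ = μ := by
  simp only [leftTranslate, one_mul, Measure.map_id']

theorem leftTranslate_sum_dirac [MeasurableMul X] {ι : Type*} (x : X) (y : ι → X) :
    leftTranslate x (Measure.sum fun i => Measure.dirac (y i)) =
      Measure.sum fun i => Measure.dirac (x * y i) := by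
  rw [leftTranslate, Measure.map_sum (measurable_const_mul x).aemeasurable]
  exact congrArg Measure.sum (funext fun i => Measure.map_dirac' (measurable_const_mul x) _)

theorem isLocallyFiniteMeasure_leftTranslate [TopologicalSpace X] [ContinuousMul X] [BorelSpace X]
    (x : X) (μ : Measure X) [IsLocallyFiniteMeasure μ] :
    IsLocallyFiniteMeasure (leftTranslate x μ) := by
  refine ⟨fun y => ?_⟩
  obtain ⟨U, hy, hU, h_lt⟩ := μ.exists_isOpen_measure_lt_top (x⁻¹ * y)
  have hU' : IsOpen ((fun z => x⁻¹ * z) ⁻¹' U) := hU.preimage (continuous_const_mul _)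
  refine ⟨_, hU'.mem_nhds hy, ?_⟩
  rw [leftTranslate, Measure.map_apply (measurable_const_mul x) hU'.measurableSet, ← preimage_comp]
  simpa only [Function.comp_def, inv_mul_cancel_left, preimage_id'] using h_lt

theorem measure_sum_dirac_apply {ι α : Type*} [MeasurableSpace α] (y : ι → α) {B : Set α}
    (hB : MeasurableSet B) :
    Measure.sum (fun i => Measure.dirac (y i)) B = ({i | y i ∈ B}.encard : ℝ≥0∞) := by
  rw [Measure.sum_apply _ hB, ← ENNReal.tsum_set_one, tsum_subtype _ fun _ => (1 : ℝ≥0∞)]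
  exact tsum_congr fun i => Measure.dirac_apply' _ hB

theorem measurableSet_setOf_isLocallyFiniteMeasure {α S : Type*} [TopologicalSpace α]
    [WeaklyLocallyCompactSpace α] [SigmaCompactSpace α] [T2Space α] [MeasurableSpace α]
    [OpensMeasurableSpace α] [MeasurableSpace S] {μ : S → Measure α} (hμ : Measurable μ) :
    MeasurableSet {a | IsLocallyFiniteMeasure (μ a)} := by
  let K := CompactExhaustion.choice α
  have h_iff (a : S) : IsLocallyFiniteMeasure (μ a) ↔ ∀ n, μ a (K n) < ∞ := by
    refine ⟨fun _ n => (K.isCompact n).measure_lt_top, fun h => ⟨fun x => ?_⟩⟩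
    obtain ⟨n, hn⟩ := K.exists_mem_nhds x
    exact ⟨K n, hn, h n⟩
  simp only [h_iff, ofPred_forall]
  exact MeasurableSet.iInter fun n => measurableSet_lt
    ((Measure.measurable_coe (K.isCompact n).measurableSet).comp hμ) measurable_const

end LeftTranslate

section TransportMeasure

variable {X : Type*} [Group X] [MeasurableSpace X] {Ξ : Type u} [MetricSpace Ξ] {c : Ξ → X}

variable (c) in
/-- The sum of the Dirac measures at the transports from the root to all vertices. -/
noncomputable def transportMeasure (a : NetworkClass Ξ 1) : Measure X :=
  (vertexMeasure a).map (transportClass c)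

variable (c) in
/-- The classes of consistent networks whose transports from the root to the vertices form a locally
finite configuration. -/
def embeddableClasses [TopologicalSpace X] : Set (NetworkClass Ξ 1) :=
  consistentClasses c ∩ {a | IsLocallyFiniteMeasure (transportMeasure c a)}

open Classical in
variable (c) in
/-- The position of the second vertex relative to the first one, as seen by the embedding: the
transport between them, or `1` for the networks which the embedding collapses. -/
noncomputable def transition [TopologicalSpace X] (b : NetworkClass Ξ 2) : X :=
  if forget b ∈ embeddableClasses c then transportClass c b else 1

section Transition

variable [TopologicalSpace X] {G : Network Ξ} {o : G.V}

theorem transition_birooted (h : rooted G o ∈ embeddableClasses c) (v : G.V) :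
    transition c (birooted G o v) = G.transport c o v :=
  if_pos h

theorem transition_birooted_of_notMem (h : rooted G o ∉ embeddableClasses c) (v : G.V) :
    transition c (birooted G o v) = 1 :=
  if_neg h

end Transition

variable [TopologicalSpace X] [BorelSpace X] [T2Space X]

theorem transportMeasure_rooted [ContinuousMul X] (hc : Continuous c) (G : Network Ξ) (o : G.V) :
    transportMeasure c (rooted G o) = Measure.sum fun v => Measure.dirac (G.transport c o v) := by
  ext B hB
  rw [transportMeasure, Measure.map_apply (measurable_transportClass hc) hB,
    vertexMeasure_apply (measurable_transportClass hc hB), massOut_rooted, Measure.sum_apply _ hB]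
  exact tsum_congr fun v => (Measure.dirac_apply' _ hB).symm

theorem measurable_transportMeasure [ContinuousMul X] (hc : Continuous c) :
    Measurable (transportMeasure c : NetworkClass Ξ 1 → Measure X) :=
  (Measure.measurable_map _ (measurable_transportClass hc)).comp measurable_vertexMeasure

theorem exists_transportMeasure_eq_coe [ContinuousMul X] (hc : Continuous c)
    (a : NetworkClass Ξ 1) {B : Set X} (hB : MeasurableSet B) :
    ∃ n : ℕ∞, transportMeasure c a B = (n : ℝ≥0∞) := by
  obtain ⟨G, o, rfl⟩ := exists_eq_rooted a
  rw [transportMeasure_rooted hc, measure_sum_dirac_apply _ hB]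
  exact ⟨_, rfl⟩

theorem Network.Consistent.transportMeasure_rooted [ContinuousMul X] (hc : Continuous c)
    {G : Network Ξ} (hG : G.Consistent c) (o v : G.V) : transportMeasure c (rooted G v) =
      leftTranslate (G.transport c o v)⁻¹ (transportMeasure c (rooted G o)) := by
  rw [PalmNetwork.transportMeasure_rooted hc, PalmNetwork.transportMeasure_rooted hc,
    leftTranslate_sum_dirac]
  refine congrArg Measure.sum (funext fun w => congrArg Measure.dirac ?_)
  rw [← hG.transport_mul o v w, inv_mul_cancel_left]

theorem rooted_mem_embeddableClasses [ContinuousMul X] (hc : Continuous c) {G : Network Ξ}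
    {o : G.V} (v : G.V) (h : rooted G o ∈ embeddableClasses c) :
    rooted G v ∈ embeddableClasses c := by
  have hG := rooted_mem_consistentClasses.1 h.1
  refine ⟨rooted_mem_consistentClasses.2 hG, ?_⟩
  have : IsLocallyFiniteMeasure (transportMeasure c (rooted G o)) := h.2
  rw [mem_ofPred_eq, hG.transportMeasure_rooted hc o v]
  exact isLocallyFiniteMeasure_leftTranslate _ _

theorem measurableSet_embeddableClasses [ContinuousMul X] [WeaklyLocallyCompactSpace X]
    [SigmaCompactSpace X] (hc : Continuous c) :
    MeasurableSet (embeddableClasses c : Set (NetworkClass Ξ 1)) :=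
  (isClosed_consistentClasses hc).measurableSet.inter
    (measurableSet_setOf_isLocallyFiniteMeasure (measurable_transportMeasure hc))

theorem measurable_transition [ContinuousMul X] [WeaklyLocallyCompactSpace X]
    [SigmaCompactSpace X] (hc : Continuous c) :
    Measurable (transition c : NetworkClass Ξ 2 → X) :=
  Measurable.ite (continuous_forget.measurable (measurableSet_embeddableClasses hc))
    (measurable_transportClass hc) measurable_const

theorem transition_symm [ContinuousMul X] (hc : Continuous c) (G : Network Ξ) (o v : G.V) :
    transition c (birooted G v o) = (transition c (birooted G o v))⁻¹ := by
  by_cases h : rooted G o ∈ embeddableClasses c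
  · rw [transition_birooted h, transition_birooted (rooted_mem_embeddableClasses hc v h)]
    exact (rooted_mem_consistentClasses.1 h.1).transport_symm o v
  · rw [transition_birooted_of_notMem h, inv_one,
      transition_birooted_of_notMem (mt (rooted_mem_embeddableClasses hc o) h)]

end TransportMeasure

section Embedding

variable {X : Type*} [Group X] [TopologicalSpace X] [ContinuousMul X] [T2Space X]
  [MeasurableSpace X] [BorelSpace X] {Ξ : Type u} [MetricSpace Ξ] {c : Ξ → X}

open Classical in
/-- The embedding `ψ` of the networks with consistent marks into the group; all networks which are
not embeddable are mapped to the Dirac measure at the neutral element. -/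
noncomputable def embedding (hc : Continuous c) (a : NetworkClass Ξ 1) : CountingMeasure X :=
  if h : a ∈ embeddableClasses c then
    ⟨transportMeasure c a, h.2, fun _ hB => exists_transportMeasure_eq_coe hc a hB⟩
  else ⟨Measure.dirac 1, inferInstance, fun B hB =>
    ⟨B.indicator 1 1, by
      rw [Measure.dirac_apply' _ hB]
      by_cases h : (1 : X) ∈ B <;> simp [h]⟩⟩

theorem coe_embedding (hc : Continuous c) {a : NetworkClass Ξ 1} (h : a ∈ embeddableClasses c) :
    (embedding hc a : Measure X) = transportMeasure c a :=
  congrArg Subtype.val (dif_pos h)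

theorem coe_embedding_of_notMem (hc : Continuous c) {a : NetworkClass Ξ 1}
    (h : a ∉ embeddableClasses c) : (embedding hc a : Measure X) = Measure.dirac 1 :=
  congrArg Subtype.val (dif_neg h)

theorem measurable_embedding [WeaklyLocallyCompactSpace X] [SigmaCompactSpace X]
    (hc : Continuous c) : Measurable (embedding hc : NetworkClass Ξ 1 → CountingMeasure X) := by
  classical
  have h_ite (a : NetworkClass Ξ 1) : (embedding hc a : Measure X) =
      if a ∈ embeddableClasses c then transportMeasure c a else Measure.dirac 1 := by
    split_ifs with ha
    exacts [coe_embedding hc ha, coe_embedding_of_notMem hc ha]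
  refine Measurable.subtype_mk (f := fun a => (embedding hc a : Measure X)) ?_
  simp only [h_ite]
  exact Measurable.ite (measurableSet_embeddableClasses hc) (measurable_transportMeasure hc)
    measurable_const

theorem one_mem_points_embedding (hc : Continuous c) (a : NetworkClass Ξ 1) :
    (1 : X) ∈ points (embedding hc a) := by
  change (embedding hc a : Measure X) {1} ≠ 0
  by_cases h : a ∈ embeddableClasses c
  · obtain ⟨G, o, rfl⟩ := exists_eq_rooted a
    have h_root : G.transport c o o = 1 := (rooted_mem_consistentClasses.1 h.1).transport_self o
    rw [coe_embedding hc h, transportMeasure_rooted hc,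
      measure_sum_dirac_apply _ (measurableSet_singleton _), ne_eq, ENat.toENNReal_eq_zero,
      encard_eq_zero, ← ne_eq, ← nonempty_iff_ne_empty]
    exact ⟨o, h_root⟩
  · rw [coe_embedding_of_notMem hc h, Measure.dirac_apply_of_mem (mem_singleton _)]
    exact one_ne_zero

theorem embedding_rooted_eq_leftTranslate (hc : Continuous c) (G : Network Ξ) (o v : G.V) :
    (embedding hc (rooted G v) : Measure X) =
      leftTranslate (transition c (birooted G o v))⁻¹ (embedding hc (rooted G o)) := by
  by_cases h : rooted G o ∈ embeddableClasses c
  · rw [coe_embedding hc h, coe_embedding hc (rooted_mem_embeddableClasses hc v h),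
      transition_birooted h]
    exact (rooted_mem_consistentClasses.1 h.1).transportMeasure_rooted hc o v
  · rw [coe_embedding_of_notMem hc h, transition_birooted_of_notMem h, inv_one, leftTranslate_one,
      coe_embedding_of_notMem hc (mt (rooted_mem_embeddableClasses hc o) h)]

end Embedding

/-! ## Measurability of random networks -/

section Pattern

variable {Ξ : Type u} {k : ℕ}

/-- A finite description of a ball in a network: a graph on `Fin size` with distinguished vertices,
whose marks are given as indices of a dense sequence in the mark space. There are countably many
patterns, and up to a tolerance every ball is described by one of them. -/
structure Pattern (k : ℕ) where
  size : ℕ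
  adj : Fin size → Fin size → Bool
  root : Fin k → Fin size
  vertexMark : Fin size → ℕ
  edgeMark : Fin size → Fin size → ℕ

instance : Countable (Pattern k) := by
  let toSigma (d : Pattern k) : Σ n : ℕ, (Fin n → Fin n → Bool) × (Fin k → Fin n) ×
      (Fin n → ℕ) × (Fin n → Fin n → ℕ) :=
    ⟨d.size, d.adj, d.root, d.vertexMark, d.edgeMark⟩
  have h_injective : Function.Injective toSigma := by
    rintro ⟨⟩ ⟨⟩ h
    simp only [toSigma, Sigma.mk.injEq] at h
    obtain ⟨rfl, h⟩ := h
    simp only [heq_eq_eq, Prod.mk.injEq] at h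
    obtain ⟨rfl, rfl, rfl, rfl⟩ := h
    rfl
  exact h_injective.countable

variable [MetricSpace Ξ]

/-- The tuple `g` of elements of `V` enumerates the set `ball` and realizes the pattern `d`, up to
an error `ε` in the marks, which are decoded along the sequence `q`. The graph, the distinguished
elements and the marks on `V` are given by `adj`, `ρ`, `a` and `b`. -/
structure Pattern.IsRealizedBy (d : Pattern k) (q : ℕ → Ξ) (ε : ℝ) {V : Type*}
    (adj : V → V → Prop) (ball : Set V) (ρ : Fin k → V) (a : V → Ξ) (b : V → V → Ξ)
    (g : Fin d.size → V) : Prop where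
  injective : ∀ i j, g i = g j → i = j
  mem_ball : ∀ i, g i ∈ ball
  exists_eq : ∀ v ∈ ball, ∃ i, g i = v
  adj_iff : ∀ i j, d.adj i j = true ↔ adj (g i) (g j)
  root_eq : ∀ l, g (d.root l) = ρ l
  dist_vertexMark_le : ∀ i, dist (a (g i)) (q (d.vertexMark i)) ≤ ε
  dist_edgeMark_le : ∀ i j, d.adj i j = true → dist (b (g i) (g j)) (q (d.edgeMark i j)) ≤ ε

/-- The pattern `d` describes the ball of radius `n` in `A` up to an error `1 / (2 * n)` in the
marks: half of what `PointedNetwork.Close` tolerates, so that two networks matching the same pattern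
are close. -/
def Pattern.Matches (d : Pattern k) (q : ℕ → Ξ) (n : ℕ) (A : PointedNetwork Ξ k) : Prop :=
  ∃ g, d.IsRealizedBy q (1 / (2 * n)) A.graph.Adj (A.ball n) A.root A.vertexMark A.edgeMark g

variable {q : ℕ → Ξ} {n : ℕ} {d : Pattern k} {A B : PointedNetwork Ξ k}

theorem Pattern.IsRealizedBy.exists_equiv {ε : ℝ} {V : Type*} {adj : V → V → Prop} {ball : Set V}
    {ρ : Fin k → V} {a : V → Ξ} {b : V → V → Ξ} {g : Fin d.size → V}
    (h : d.IsRealizedBy q ε adj ball ρ a b g) : ∃ σ : Fin d.size ≃ ball, ∀ i, (σ i : V) = g i :=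
  ⟨Equiv.ofBijective (fun i => ⟨g i, h.mem_ball i⟩)
    ⟨fun i j hij => h.injective i j (congrArg Subtype.val hij), fun v =>
      (h.exists_eq v v.2).imp fun _ hi => Subtype.ext hi⟩, fun _ => rfl⟩

theorem Pattern.Matches.close (hA : d.Matches q n A) (hB : d.Matches q n B) : A.Close n B := by
  obtain ⟨f, hf⟩ := hA
  obtain ⟨g, hg⟩ := hB
  obtain ⟨σ, hσ⟩ := hf.exists_equiv
  obtain ⟨τ, hτ⟩ := hg.exists_equiv
  have h_double : (1 / (2 * n) + 1 / (2 * n) : ℝ) = 1 / n := by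
    rw [← two_mul, one_div, mul_inv, mul_inv_cancel_left₀ two_ne_zero, one_div]
  have h_adj (i j) : B.graph.Adj (τ i) (τ j) ↔ A.graph.Adj (σ i) (σ j) := by
    rw [hσ, hσ, hτ, hτ, ← hf.adj_iff, ← hg.adj_iff]
  refine ⟨⟨σ.symm.trans τ, fun {v w} => ?_⟩, fun l v hv => ?_, fun v => ?_, fun v w hvw => ?_⟩
  · obtain ⟨i, rfl⟩ := σ.surjective v
    obtain ⟨j, rfl⟩ := σ.surjective w
    simpa using h_adj i j
  · have h_root : v = σ (d.root l) := Subtype.ext (by rw [hv, hσ, hf.root_eq])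
    subst h_root
    change (τ (σ.symm (σ (d.root l))) : B.V) = B.root l
    rw [Equiv.symm_apply_apply, hτ, hg.root_eq]
  · obtain ⟨i, rfl⟩ := σ.surjective v
    change dist _ (B.vertexMark (τ (σ.symm (σ i)))) ≤ _
    rw [Equiv.symm_apply_apply, hσ, hτ, ← h_double]
    exact (dist_triangle_right _ _ _).trans
      (add_le_add (hf.dist_vertexMark_le i) (hg.dist_vertexMark_le i))
  · obtain ⟨i, rfl⟩ := σ.surjective v
    obtain ⟨j, rfl⟩ := σ.surjective w
    change dist _ (B.edgeMark (τ (σ.symm (σ i))) (τ (σ.symm (σ j)))) ≤ _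
    rw [hσ, hσ] at hvw
    rw [Equiv.symm_apply_apply, Equiv.symm_apply_apply, hσ, hσ, hτ, hτ, ← h_double]
    have h_pattern := (hf.adj_iff i j).2 hvw
    exact (dist_triangle_right _ _ _).trans
      (add_le_add (hf.dist_edgeMark_le i j h_pattern) (hg.dist_edgeMark_le i j h_pattern))

theorem PointedNetwork.finite_ball {Ξ : Type u} (A : PointedNetwork Ξ k) (r : ℝ) :
    (A.ball r).Finite := by
  have h_union : A.ball r = ⋃ i, {v | A.graph.dist (A.root i) v ≤ ⌈r⌉₊} := by
    ext v
    simp only [PointedNetwork.ball, mem_ofPred_eq, mem_iUnion]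
  rw [h_union]
  exact finite_iUnion fun i => finite_setOf_dist_le A.connected A.locallyFinite _ _

theorem exists_pattern_matches (hq : DenseRange q) (hn : 0 < n) (A : PointedNetwork Ξ k) :
    ∃ d : Pattern k, d.Matches q n A := by
  classical
  have := (A.finite_ball n).to_subtype
  obtain ⟨p, ⟨σ⟩⟩ := Finite.exists_equiv_fin (A.ball n)
  have h_pos : (0 : ℝ) < 1 / (2 * n) := by positivity
  choose code h_code using fun x : Ξ => hq.exists_dist_lt x h_pos
  refine ⟨⟨p, fun i j => decide (A.graph.Adj (σ.symm i) (σ.symm j)),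
    fun l => σ ⟨A.root l, A.root_mem_ball _ l⟩, fun i => code (A.vertexMark (σ.symm i)),
    fun i j => code (A.edgeMark (σ.symm i) (σ.symm j))⟩, fun i => σ.symm i, ?_⟩
  exact
    { injective := fun i j h => σ.symm.injective (Subtype.ext h)
      mem_ball := fun i => (σ.symm i).2
      exists_eq := fun v hv => ⟨σ ⟨v, hv⟩, by rw [Equiv.symm_apply_apply]⟩
      adj_iff := fun i j => decide_eq_true_iff
      root_eq := fun l => by rw [Equiv.symm_apply_apply]
      dist_vertexMark_le := fun i => (h_code _).le
      dist_edgeMark_le := fun i j _ => (h_code _).le }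

theorem measurable_mk_of_matches {S : Type*} [MeasurableSpace S] (hq : DenseRange q)
    {N : S → PointedNetwork Ξ k}
    (hN : ∀ n (d : Pattern k), MeasurableSet {s | d.Matches q n (N s)}) :
    Measurable (β := NetworkClass Ξ k) fun s => Quotient.mk _ (N s) := by
  let networkClass (s : S) : NetworkClass Ξ k := Quotient.mk _ (N s)
  refine measurable_of_isOpen (f := networkClass) fun U hU => ?_
  let inside : Set (ℕ × Pattern k) := {p | ∀ s, p.2.Matches q p.1 (N s) → networkClass s ∈ U}
  have h_preimage : networkClass ⁻¹' U = ⋃ p ∈ inside, {s | p.2.Matches q p.1 (N s)} := by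
    ext s
    simp only [mem_preimage, mem_iUnion, mem_ofPred_eq, exists_prop]
    refine ⟨fun hs => ?_, fun ⟨_, hp, hs⟩ => hp s hs⟩
    have h_close := tendsto_natCast_atTop_atTop.eventually (NetworkClass.isOpen_iff.1 hU (N s) hs)
    obtain ⟨n, hnU, hn⟩ := (h_close.and (eventually_gt_atTop 0)).exists
    obtain ⟨d, hd⟩ := exists_pattern_matches hq hn (N s)
    exact ⟨(n, d), fun s' hs' => hnU (N s') (hd.close hs'), hd⟩
  rw [h_preimage]
  exact MeasurableSet.biUnion (to_countable _) fun p _ => hN p.1 p.2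

end Pattern

section Reach

variable {X : Type*} [TopologicalSpace X] [MeasurableSpace X] {S : Type*}
  {μ : S → CountingMeasure X}

/-- The triples `(s, x, y)` such that `x` and `y` are joined, in the graph on the points of `μ s`
with edge set `E`, by a walk of length at most `n`. -/
def reachSet (μ : S → CountingMeasure X) (E : Set (S × X × X)) : ℕ → Set (S × X × X)
  | 0 => {p | p.2.1 = p.2.2}
  | n + 1 => {p | p.2.1 = p.2.2} ∪
      {p | ∃ z ∈ points (μ p.1), (p.1, p.2.1, z) ∈ E ∧ (p.1, z, p.2.2) ∈ reachSet μ E n}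

theorem mem_reachSet_iff {E : Set (S × X × X)} {s : S} {V : Type*} {G : SimpleGraph V}
    (hG : G.Connected) {ι : V → X} (hι : Function.Injective ι) (h_range : range ι = points (μ s))
    (hE : ∀ v w, G.Adj v w ↔ (s, ι v, ι w) ∈ E) {n : ℕ} {v w : V} :
    (s, ι v, ι w) ∈ reachSet μ E n ↔ G.dist v w ≤ n := by
  induction n generalizing v with
  | zero => rw [Nat.le_zero, hG.dist_eq_zero_iff]; exact hι.eq_iff
  | succ n ih =>
    constructor
    · rintro (h | ⟨z, hz, h_first, h_rest⟩)
      · rw [hι h, SimpleGraph.dist_self]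
        exact Nat.zero_le _
      · rw [← h_range] at hz
        obtain ⟨u, rfl⟩ := hz
        have h_adj : G.dist v u = 1 := SimpleGraph.dist_eq_one_iff_adj.2 ((hE v u).2 h_first)
        have h_dist := hG.dist_triangle (u := v) (v := u) (w := w)
        have h_dist' := ih.1 h_rest
        omega
    · intro h
      obtain ⟨p, hp⟩ := hG.exists_walk_length_eq_dist v w
      cases p with
      | nil => exact Or.inl rfl
      | @cons _ u _ h_adj p =>
        rw [SimpleGraph.Walk.length_cons] at hp
        refine Or.inr ⟨ι u, h_range ▸ mem_range_self u, (hE v u).1 h_adj, ih.2 ?_⟩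
        exact (SimpleGraph.dist_le p).trans (by omega)

end Reach

section Placement

variable {X : Type*} {Ξ : Type u} {k : ℕ}

/-- The map `ι` places the vertices of the network `N` bijectively on the set `T`, in such a way
that edges, distinguished vertices and marks are those given by `adj`, `ρ`, `a` and `b`. -/
structure IsPlacement (N : PointedNetwork Ξ k) (ι : N.V → X) (T : Set X) (adj : X → X → Prop)
    (ρ : Fin k → X) (a : X → Ξ) (b : X → X → Ξ) : Prop where
  injective : Function.Injective ι
  range_eq : range ι = T
  adj_iff : ∀ v w, N.graph.Adj v w ↔ adj (ι v) (ι w)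
  root_eq : ∀ l, ι (N.root l) = ρ l
  vertexMark_eq : ∀ v, N.vertexMark v = a (ι v)
  edgeMark_eq : ∀ v w, N.graph.Adj v w → N.edgeMark v w = b (ι v) (ι w)

variable {N : PointedNetwork Ξ k} {ι : N.V → X} {T : Set X} {adj : X → X → Prop} {ρ : Fin k → X}
  {a : X → Ξ} {b : X → X → Ξ}
theorem IsPlacement.image_ball [TopologicalSpace X] [MeasurableSpace X] {S : Type*}
    {μ : S → CountingMeasure X} {E : Set (S × X × X)} {s : S}
    (h : IsPlacement N ι (points (μ s)) (fun x y => (s, x, y) ∈ E) ρ a b) (n : ℕ) :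
    ι '' N.ball n = {x ∈ points (μ s) | ∃ l, (s, ρ l, x) ∈ reachSet μ E n} := by
  have h_ball (v : N.V) : v ∈ N.ball n ↔ ∃ l, (s, ρ l, ι v) ∈ reachSet μ E n := by
    simp only [PointedNetwork.ball, Nat.ceil_natCast, mem_ofPred_eq, ← h.root_eq,
      mem_reachSet_iff N.connected h.injective h.range_eq h.adj_iff]
  ext x
  rw [mem_ofPred_eq, ← h.range_eq]
  constructor
  · rintro ⟨v, hv, rfl⟩
    exact ⟨mem_range_self v, (h_ball v).1 hv⟩
  · rintro ⟨⟨v, rfl⟩, hv⟩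
    exact mem_image_of_mem ι ((h_ball v).2 hv)

variable [MetricSpace Ξ] {d : Pattern k} {q : ℕ → Ξ}

theorem IsPlacement.isRealizedBy_comp_iff (h : IsPlacement N ι T adj ρ a b) {ε : ℝ} {B : Set N.V}
    {g : Fin d.size → N.V} :
    d.IsRealizedBy q ε adj (ι '' B) ρ a b (ι ∘ g) ↔
      d.IsRealizedBy q ε N.graph.Adj B N.root N.vertexMark N.edgeMark g := by
  have h_adj_iff : (∀ i j, d.adj i j = true ↔ adj (ι (g i)) (ι (g j))) ↔
      ∀ i j, d.adj i j = true ↔ N.graph.Adj (g i) (g j) := by simp only [h.adj_iff]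
  constructor
  · rintro ⟨h_inj, h_mem, h_exists, h_adj, h_root, h_vertex, h_edge⟩
    have h_adj' := h_adj_iff.1 h_adj
    refine ⟨fun i j hij => h_inj i j (congrArg ι hij), fun i => ?_, fun v hv => ?_, h_adj',
      fun l => h.injective ((h_root l).trans (h.root_eq l).symm), fun i => ?_, fun i j hij => ?_⟩
    · exact h.injective.mem_set_image.1 (h_mem i)
    · exact (h_exists (ι v) (mem_image_of_mem ι hv)).imp fun _ hi => h.injective hi
    · exact h.vertexMark_eq (g i) ▸ h_vertex i
    · exact h.edgeMark_eq _ _ ((h_adj' i j).1 hij) ▸ h_edge i j hij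
  · rintro ⟨h_inj, h_mem, h_exists, h_adj, h_root, h_vertex, h_edge⟩
    refine ⟨fun i j hij => h_inj i j (h.injective hij), fun i => mem_image_of_mem ι (h_mem i), ?_,
      h_adj_iff.2 h_adj, fun l => (congrArg ι (h_root l)).trans (h.root_eq l),
      fun i => h.vertexMark_eq (g i) ▸ h_vertex i,
      fun i j hij => h.edgeMark_eq _ _ ((h_adj i j).1 hij) ▸ h_edge i j hij⟩
    rintro _ ⟨v, hv, rfl⟩
    exact (h_exists v hv).imp fun _ hi => congrArg ι hi

theorem IsPlacement.matches_iff (h : IsPlacement N ι T adj ρ a b) {n : ℕ} :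
    d.Matches q n N ↔ ∃ f : Fin d.size → X, (∀ i, f i ∈ T) ∧
      d.IsRealizedBy q (1 / (2 * n)) adj (ι '' N.ball n) ρ a b f := by
  constructor
  · rintro ⟨g, hg⟩
    exact ⟨ι ∘ g, fun i => h.range_eq ▸ mem_range_self (g i), h.isRealizedBy_comp_iff.2 hg⟩
  · rintro ⟨f, -, hf⟩
    choose g _ hg using hf.mem_ball
    obtain rfl : ι ∘ g = f := funext hg
    exact ⟨g, h.isRealizedBy_comp_iff.1 hf⟩

end Placement

section Measurability

variable {X : Type u} [Group X] [TopologicalSpace X] [IsTopologicalGroup X]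
  [LocallyCompactSpace X] [SecondCountableTopology X] [T2Space X]
  [MeasurableSpace X] [BorelSpace X]
  {S : Type v} [MeasurableSpace S] {μ : S → CountingMeasure X}

theorem measurableSet_exists_tuple_points (hμ : Measurable μ) {p : ℕ} {T : Set (S × (Fin p → X))}
    (hT : MeasurableSet T) :
    MeasurableSet {s | ∃ f : Fin p → X, (∀ i, f i ∈ points (μ s)) ∧ (s, f) ∈ T} := by
  induction p with
  | zero =>
    have h_preimage : {s | ∃ f : Fin 0 → X, (∀ i, f i ∈ points (μ s)) ∧ (s, f) ∈ T} =
        (fun s => (s, (Fin.elim0 : Fin 0 → X))) ⁻¹' T := by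
      ext s
      refine ⟨fun ⟨f, _, hf⟩ => ?_, fun h => ⟨_, fun i => i.elim0, h⟩⟩
      rwa [Subsingleton.elim f Fin.elim0] at hf
    rw [h_preimage]
    exact measurable_prodMk_right hT
  | succ p ih =>
    have h_cons : Measurable fun a : (S × (Fin p → X)) × X =>
        (a.1.1, (Fin.cons a.2 a.1.2 : Fin (p + 1) → X)) := by
      refine Measurable.prodMk (by fun_prop) (measurable_pi_lambda _ (Fin.cases ?_ fun j => ?_))
      · simpa only [Fin.cons_zero] using measurable_snd
      · simp only [Fin.cons_succ]
        fun_prop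
    convert ih (measurableSet_exists_mem_points (hμ.comp measurable_fst) (h_cons hT)) using 1
    ext s
    constructor
    · rintro ⟨f, hf, hfT⟩
      refine ⟨Fin.tail f, fun i => hf _, f 0, hf 0, ?_⟩
      simpa only [mem_preimage, Fin.cons_self_tail] using hfT
    · rintro ⟨f, hf, x, hx, hfT⟩
      exact ⟨Fin.cons x f, fun i => Fin.cases hx hf i, hfT⟩

theorem measurableSet_reachSet (hμ : Measurable μ) {E : Set (S × X × X)} (hE : MeasurableSet E)
    (n : ℕ) : MeasurableSet (reachSet μ E n) := by
  have h_diagonal : MeasurableSet {p : S × X × X | p.2.1 = p.2.2} :=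
    measurableSet_eq_fun (by fun_prop) (by fun_prop)
  induction n with
  | zero => exact h_diagonal
  | succ n ih =>
    have h_first : Measurable fun p : (S × X × X) × X => (p.1.1, p.1.2.1, p.2) := by fun_prop
    have h_rest : Measurable fun p : (S × X × X) × X => (p.1.1, p.2, p.1.2.2) := by fun_prop
    exact h_diagonal.union <| measurableSet_exists_mem_points (hμ.comp measurable_fst)
      ((h_first hE).inter (h_rest ih))

variable {Ξ : Type*} [MetricSpace Ξ] [MeasurableSpace Ξ] [OpensMeasurableSpace Ξ] {k : ℕ}
  {E : Set (S × X × X)} {ρ : S → Fin k → X} {a : S → X → Ξ} {b : S → X → X → Ξ}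

theorem measurableSet_isRealizedBy (hμ : Measurable μ) (hE : MeasurableSet E) (hρ : Measurable ρ)
    (ha : Measurable fun p : S × X => a p.1 p.2)
    (hb : Measurable fun p : S × X × X => b p.1 p.2.1 p.2.2)
    {B : Set (S × X)} (hB : MeasurableSet B) (d : Pattern k) (q : ℕ → Ξ) (ε : ℝ) :
    MeasurableSet {p : S × (Fin d.size → X) | d.IsRealizedBy q ε (fun x y => (p.1, x, y) ∈ E)
      {x ∈ points (μ p.1) | (p.1, x) ∈ B} (ρ p.1) (a p.1) (b p.1) p.2} := by
  have h_point (i) : Measurable fun p : S × (Fin d.size → X) => (p.1, p.2 i) := by fun_prop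
  have h_pair (i j) : Measurable fun p : S × (Fin d.size → X) => (p.1, p.2 i, p.2 j) := by
    fun_prop
  have h_injective (i j) : Measurable fun p : S × (Fin d.size → X) => p.2 i = p.2 j → i = j :=
    (measurableSet_setOfPred.1 (measurableSet_eq_fun (by fun_prop) (by fun_prop))).imp
      measurable_const
  have h_mem (i) : Measurable fun p : S × (Fin d.size → X) =>
      p.2 i ∈ points (μ p.1) ∧ (p.1, p.2 i) ∈ B :=
    measurableSet_setOfPred.1
      ((measurableSet_mem_points (hμ.comp measurable_fst) (by fun_prop)).inter (h_point i hB))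
  have h_missed : MeasurableSet {p : S × (Fin d.size → X) |
      ∃ x ∈ points (μ p.1), (p, x) ∈ {r | (r.1.1, r.2) ∈ B ∧ ∀ i, r.2 ≠ r.1.2 i}} := by
    refine measurableSet_exists_mem_points (hμ.comp measurable_fst) ?_
    have h_left : Measurable fun r : (S × (Fin d.size → X)) × X => (r.1.1, r.2) := by fun_prop
    refine (h_left hB).inter (measurableSet_setOfPred.2 (Measurable.forall fun i => ?_))
    exact measurableSet_setOfPred.1 (measurableSet_eq_fun (by fun_prop) (by fun_prop)).compl
  have h_adj (i j) : Measurable fun p : S × (Fin d.size → X) =>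
      d.adj i j = true ↔ (p.1, p.2 i, p.2 j) ∈ E :=
    measurable_const.iff (measurableSet_setOfPred.1 (h_pair i j hE))
  have h_root (l) : Measurable fun p : S × (Fin d.size → X) => p.2 (d.root l) = ρ p.1 l :=
    measurableSet_setOfPred.1 (measurableSet_eq_fun (by fun_prop) (by fun_prop))
  have h_vertex (i) : Measurable fun p : S × (Fin d.size → X) =>
      dist (a p.1 (p.2 i)) (q (d.vertexMark i)) ≤ ε :=
    measurableSet_setOfPred.1 ((ha.comp (h_point i)) Metric.isClosed_closedBall.measurableSet)
  have h_edge (i j) : Measurable fun p : S × (Fin d.size → X) => d.adj i j = true →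
      dist (b p.1 (p.2 i) (p.2 j)) (q (d.edgeMark i j)) ≤ ε :=
    measurable_const.imp <|
      measurableSet_setOfPred.1 ((hb.comp (h_pair i j)) Metric.isClosed_closedBall.measurableSet)
  convert measurableSet_setOfPred.2 <| (Measurable.forall fun i => .forall (h_injective i)).and <|
    (Measurable.forall h_mem).and <| (measurableSet_setOfPred.1 h_missed.compl).and <|
    (Measurable.forall fun i => .forall (h_adj i)).and <| (Measurable.forall h_root).and <|
    (Measurable.forall h_vertex).and <| Measurable.forall fun i => .forall (h_edge i) using 1
  ext p
  have h_exists : (∀ x ∈ {x ∈ points (μ p.1) | (p.1, x) ∈ B}, ∃ i, p.2 i = x) ↔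
      ¬∃ x ∈ points (μ p.1), (p.1, x) ∈ B ∧ ∀ i, x ≠ p.2 i := by
    simp only [mem_ofPred_eq, not_exists, not_and, not_forall, not_not, and_imp, eq_comm]
  exact ⟨fun ⟨h1, h2, h3, h4, h5, h6, h7⟩ => ⟨h1, h2, h_exists.1 h3, h4, h5, h6, h7⟩,
    fun ⟨h1, h2, h3, h4, h5, h6, h7⟩ => ⟨h1, h2, h_exists.2 h3, h4, h5, h6, h7⟩⟩

theorem measurable_mk_of_isPlacement [TopologicalSpace.SeparableSpace Ξ] [Nonempty Ξ]
    (hμ : Measurable μ) (hE : MeasurableSet E) (hρ : Measurable ρ)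
    (ha : Measurable fun p : S × X => a p.1 p.2)
    (hb : Measurable fun p : S × X × X => b p.1 p.2.1 p.2.2)
    {N : S → PointedNetwork Ξ k} {ι : ∀ s, (N s).V → X}
    (h : ∀ s, IsPlacement (N s) (ι s) (points (μ s)) (fun x y => (s, x, y) ∈ E) (ρ s) (a s) (b s)) :
    Measurable (β := NetworkClass Ξ k) fun s => Quotient.mk _ (N s) := by
  obtain ⟨q, hq⟩ := TopologicalSpace.exists_dense_seq Ξ
  refine measurable_mk_of_matches hq fun n d => ?_
  have h_reach : MeasurableSet {p : S × X | ∃ l, (p.1, ρ p.1 l, p.2) ∈ reachSet μ E n} := by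
    refine measurableSet_setOfPred.2 (Measurable.exists fun l => measurableSet_setOfPred.1 ?_)
    have h_triple : Measurable fun p : S × X => (p.1, ρ p.1 l, p.2) := by fun_prop
    exact h_triple (measurableSet_reachSet hμ hE n)
  simp only [(h _).matches_iff, (h _).image_ball]
  exact measurableSet_exists_tuple_points hμ
    (measurableSet_isRealizedBy hμ hE hρ ha hb h_reach d q _)

end Measurability

/-! ## The network of a connectible point process -/

section InvariantCore

instance {X S T : Type*} [SMul X S] [SMul X T] [MeasurableSpace X] [MeasurableSpace S]
    [MeasurableSpace T] [MeasurableSMul₂ X S] [MeasurableSMul₂ X T] : MeasurableSMul₂ X (S × T) :=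
  ⟨(measurable_fst.smul measurable_snd.fst).prodMk (measurable_fst.smul measurable_snd.snd)⟩

variable {X : Type*} [Group X] [MeasurableSpace X] {S : Type*} [MulAction X S]

/-- The points almost all of whose translates lie in `F`. If `μ` is right invariant, this set is
invariant under all translations, and it replaces `F` where invariance of `F` holds only up to null
sets. -/
def invariantCore (μ : Measure X) (F : Set S) : Set S :=
  {s | ∀ᵐ z ∂μ, z • s ∈ F}

variable {μ : Measure X} {F : Set S}

theorem smul_mem_invariantCore [MeasurableMul X] [μ.IsMulRightInvariant] {s : S}
    (h : s ∈ invariantCore μ F) (x : X) : x • s ∈ invariantCore μ F := by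
  have h' : μ {z | z • s ∈ F}ᶜ = 0 := h
  rw [← measure_preimage_mul_right μ x] at h'
  refine (congrArg μ ?_).trans h'
  ext z
  simp only [mem_compl_iff, mem_ofPred_eq, mem_preimage, smul_smul]

theorem exists_smul_mem_of_mem_invariantCore [NeZero μ] {s : S} (h : s ∈ invariantCore μ F) :
    ∃ z : X, z • s ∈ F :=
  (show ∀ᵐ z ∂μ, z • s ∈ F from h).exists

theorem mem_invariantCore_iff [NeZero μ] {s : S} {r : Prop} (h : ∀ᵐ z ∂μ, (z • s ∈ F ↔ r)) :
    s ∈ invariantCore μ F ↔ r :=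
  (eventually_congr h).trans eventually_const

variable [MeasurableSpace S] [MeasurableSMul₂ X S] [SFinite μ]

theorem measurableSet_invariantCore (hF : MeasurableSet F) :
    MeasurableSet (invariantCore μ F) := by
  have h_smul : MeasurableSet {p : S × X | p.2 • p.1 ∈ Fᶜ} :=
    (show Measurable fun p : S × X => p.2 • p.1 by fun_prop) hF.compl
  exact measurable_measure_prodMk_left h_smul (measurableSet_singleton 0)

theorem ae_mem_invariantCore {P : Measure S} [SFinite P] [SMulInvariantMeasure X S P]
    (hF : MeasurableSet F) (h : ∀ᵐ s ∂P, s ∈ F) : ∀ᵐ s ∂P, s ∈ invariantCore μ F := by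
  have h_smul : MeasurableSet {p : S × X | p.2 • p.1 ∈ Fᶜ} :=
    (show Measurable fun p : S × X => p.2 • p.1 by fun_prop) hF.compl
  refine Measure.measure_ae_null_of_prod_null (μ := P) (ν := μ) (s := {p | p.2 • p.1 ∈ Fᶜ}) ?_
  rw [Measure.prod_apply_symm h_smul]
  refine (lintegral_congr fun z => ?_).trans lintegral_zero
  exact (measure_preimage_smul_of_nullMeasurableSet hF.compl.nullMeasurableSet z).trans h

end InvariantCore

section EquivariantGraph

variable {X : Type u} [Group X] {Ω : Type v} [MulAction X Ω]
  {G : Ω → (⊤ : SimpleGraph X).Subgraph}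

/-- The random graph `G` commutes with translations. -/
def EquivariantGraph (G : Ω → (⊤ : SimpleGraph X).Subgraph) : Prop :=
  ∀ (z : X) (ω : Ω),
    (∀ x : X, x ∈ (G ω).verts ↔ z * x ∈ (G (z • ω)).verts) ∧
    (∀ x y : X, (G ω).Adj x y ↔ (G (z • ω)).Adj (z * x) (z * y))

/-- The translation by `z` as an isomorphism of graphs. -/
def EquivariantGraph.iso (hG : EquivariantGraph G) (z : X) (ω : Ω) :
    (G ω).coe ≃g (G (z • ω)).coe where
  toFun v := ⟨z * v, ((hG z ω).1 v).1 v.2⟩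
  invFun v := ⟨z⁻¹ * v, ((hG z ω).1 _).2 (by rw [mul_inv_cancel_left]; exact v.2)⟩
  left_inv v := Subtype.ext (inv_mul_cancel_left z v)
  right_inv v := Subtype.ext (mul_inv_cancel_left z v)
  map_rel_iff' {v w} := ((hG z ω).2 v w).symm

end EquivariantGraph

section Connects

variable {X : Type u} [TopologicalSpace X] [MeasurableSpace X]

/-- `H` is a connected locally finite graph whose vertices are the atoms of the simple measure `μ`;
the empty graph is allowed. -/
structure Connects (H : (⊤ : SimpleGraph X).Subgraph) (μ : CountingMeasure X) : Prop where
  isSimple : IsSimple μ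
  preconnected : H.coe.Preconnected
  finite_neighborSet : ∀ x ∈ H.verts, (H.neighborSet x).Finite
  verts_eq : H.verts = points μ

variable [Group X] [MeasurableSingletonClass X] [MeasurableMul X]
  {Ω : Type v} [MulAction X Ω] {m : Ω → CountingMeasure X} {G : Ω → (⊤ : SimpleGraph X).Subgraph}

theorem FlowAdapted.isSimple_of_smul (hfa : FlowAdapted m) {z : X} {ω : Ω}
    (h : IsSimple (m (z • ω))) : IsSimple (m ω) := by
  intro x hx
  have h_translate := h (z * x) ((hfa.mul_mem_points_smul z ω x).2 hx)
  rw [hfa z ω, leftTranslate,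
    Measure.map_apply (measurable_const_mul z) (measurableSet_singleton _)] at h_translate
  rw [← h_translate]
  congr 1
  ext y
  simp only [mem_singleton_iff, mem_preimage, mul_right_inj]

theorem Connects.of_smul (hfa : FlowAdapted m) (hG : EquivariantGraph G) {z : X} {ω : Ω}
    (h : Connects (G (z • ω)) (m (z • ω))) : Connects (G ω) (m ω) where
  isSimple := hfa.isSimple_of_smul h.isSimple
  preconnected := h.preconnected.map (hG.iso z ω).symm.toHom (hG.iso z ω).symm.surjective
  finite_neighborSet x hx :=
    ((h.finite_neighborSet (z * x) (((hG z ω).1 x).1 hx)).preimage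
      (mul_right_injective z).injOn).subset fun y hy => ((hG z ω).2 x y).1 hy
  verts_eq := by
    ext x
    rw [(hG z ω).1 x, h.verts_eq, hfa.mul_mem_points_smul]

end Connects

section Connectible

theorem exists_measurableSet_adj {X : Type*} [MeasurableSpace X] [MeasurableEq X] {Ω : Type*}
    [MeasurableSpace Ω] {G : Ω → (⊤ : SimpleGraph X).Subgraph} {N : Ω → ℕ∞} {Y : ℕ → Ω → X}
    (hY : ∀ i, Measurable (Y i))
    (h_edge : ∀ i j : ℕ,
      MeasurableSet {ω | (i : ℕ∞) < N ω ∧ (j : ℕ∞) < N ω ∧ (G ω).Adj (Y i ω) (Y j ω)}) :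
    ∃ F : Set (Ω × X × X), MeasurableSet F ∧
      ∀ ω, (∀ x ∈ (G ω).verts, ∃ i : ℕ, (i : ℕ∞) < N ω ∧ Y i ω = x) →
        ∀ x y, (ω, x, y) ∈ F ↔ (G ω).Adj x y := by
  refine ⟨⋃ (i : ℕ) (j : ℕ), {p | Y i p.1 = p.2.1} ∩ {p | Y j p.1 = p.2.2} ∩
    Prod.fst ⁻¹' {ω | (i : ℕ∞) < N ω ∧ (j : ℕ∞) < N ω ∧ (G ω).Adj (Y i ω) (Y j ω)}, ?_, ?_⟩
  · refine .iUnion fun i => .iUnion fun j => .inter (.inter ?_ ?_) (measurable_fst (h_edge i j))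
    · exact measurableSet_eq_fun ((hY i).comp measurable_fst) (by fun_prop)
    · exact measurableSet_eq_fun ((hY j).comp measurable_fst) (by fun_prop)
  · intro ω h_verts x y
    simp only [mem_iUnion]
    constructor
    · rintro ⟨i, j, ⟨hi, hj⟩, -, -, h_adj⟩
      exact (show Y i ω = x from hi) ▸ (show Y j ω = y from hj) ▸ h_adj
    · intro h_adj
      obtain ⟨i, hi, rfl⟩ := h_verts x ((G ω).edge_vert h_adj)
      obtain ⟨j, hj, rfl⟩ := h_verts y ((G ω).edge_vert h_adj.symm)
      exact ⟨i, j, ⟨rfl, rfl⟩, hi, hj, h_adj⟩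

variable {X : Type u} [TopologicalSpace X] [MeasurableSpace X]

theorem exists_eq_of_mem_points [MeasurableSingletonClass X] {μ : CountingMeasure X} {ι : Type*}
    {y : ι → X} (hμ : (μ : Measure X) = Measure.sum fun i => Measure.dirac (y i)) {x : X}
    (hx : x ∈ points μ) : ∃ i, y i = x := by
  by_contra! h
  refine hx ?_
  have h_empty : {i | y i ∈ ({x} : Set X)} = ∅ := eq_empty_of_forall_notMem h
  rw [hμ, measure_sum_dirac_apply y (measurableSet_singleton x), h_empty, encard_empty,
    ENat.toENNReal_zero]

variable [Group X] {Ω : Type v} [MeasurableSpace Ω] [MulAction X Ω]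
  {m : Ω → CountingMeasure X}

/-- On the invariant event `A`, the equivariant random graph `G` connects the simple process `m` and
has `E` as its set of edges. -/
structure ConnectsOn (m : Ω → CountingMeasure X) (G : Ω → (⊤ : SimpleGraph X).Subgraph)
    (A : Set Ω) (E : Set (Ω × X × X)) : Prop where
  equivariant : EquivariantGraph G
  measurableSet : MeasurableSet A
  measurableSet_edges : MeasurableSet E
  smul_mem : ∀ ω ∈ A, ∀ z : X, z • ω ∈ A
  connects : ∀ ω ∈ A, Connects (G ω) (m ω)
  adj_iff : ∀ ω ∈ A, ∀ x y, (ω, x, y) ∈ E ↔ (G ω).Adj x y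

theorem Connectible.exists_connectsOn [MeasurableMul₂ X] [MeasurableEq X] [MeasurableSMul₂ X Ω]
    {P : Measure Ω} [SFinite P] [SMulInvariantMeasure X Ω P] (μ : Measure X)
    [SFinite μ] [NeZero μ] [μ.IsMulRightInvariant] (hfa : FlowAdapted m)
    (h_simple : ∀ᵐ ω ∂P, IsSimple (m ω)) (h : Connectible P m) :
    ∃ G A E, ConnectsOn m G A E ∧ ∀ᵐ ω ∂P, ω ∈ A := by
  obtain ⟨G, hG, h_graph, N, Y, -, hY, h_sum, h_edge⟩ := h
  obtain ⟨F, hF, hF_iff⟩ := exists_measurableSet_adj hY h_edge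
  have h_good : ∀ᵐ ω ∂P, Connects (G ω) (m ω) ∧ ∀ x y, (ω, x, y) ∈ F ↔ (G ω).Adj x y := by
    filter_upwards [h_simple, h_graph, h_sum] with ω hω h_conn hω_sum
    refine ⟨⟨hω, h_conn.1, h_conn.2.1, h_conn.2.2⟩, hF_iff ω fun x hx => ?_⟩
    obtain ⟨i, hi⟩ := exists_eq_of_mem_points hω_sum (h_conn.2.2 ▸ hx)
    exact ⟨i, i.2, hi⟩
  obtain ⟨B, hB_ae, hB, hB_good⟩ := h_good.exists_measurable_mem
  refine ⟨G, invariantCore μ B, invariantCore μ F, ⟨hG, measurableSet_invariantCore hB,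
    measurableSet_invariantCore hF, fun ω => smul_mem_invariantCore, fun ω hω => ?_,
    fun ω hω x y => mem_invariantCore_iff ?_⟩, ae_mem_invariantCore hB hB_ae⟩
  · obtain ⟨z, hz⟩ := exists_smul_mem_of_mem_invariantCore hω
    exact (hB_good _ hz).1.of_smul hfa hG
  · filter_upwards [hω] with z hz
    exact ((hB_good _ hz).2 _ _).trans ((hG z ω).2 x y).symm

end Connectible

section PointNetwork

variable {X : Type u} [Group X] [TopologicalSpace X] [MeasurableSpace X] {Ξ : Type u}
  [MetricSpace Ξ] (c : Ξ ≃ₜ X) {H : (⊤ : SimpleGraph X).Subgraph} {μ : CountingMeasure X}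

/-- A graph on the points of `μ` as a network: the mark of the edge from `x` to `y` is `x⁻¹ y`, and
vertices carry no information. -/
def Connects.network (h : Connects H μ) (h_one : (1 : X) ∈ points μ) : Network Ξ where
  V := points μ
  graph := H.spanningCoe.induce (points μ)
  connected := by
    let φ : H.coe →g H.spanningCoe.induce (points μ) := ⟨Equiv.setCongr h.verts_eq, fun hvw => hvw⟩
    have : Nonempty (points μ) := ⟨⟨1, h_one⟩⟩
    exact ⟨h.preconnected.map φ (Equiv.setCongr h.verts_eq).surjective⟩
  locallyFinite v := by
    have hv : (v : X) ∈ H.verts := by rw [h.verts_eq]; exact v.2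
    exact (h.finite_neighborSet v hv).preimage Subtype.val_injective.injOn
  vertexMark _ := c.symm 1
  edgeMark x y := c.symm ((x : X)⁻¹ * y)

namespace Connects

theorem walkProd_network (h : Connects H μ) (h_one : (1 : X) ∈ points μ) {x y : points μ}
    (p : (h.network c h_one).graph.Walk x y) :
    (h.network c h_one).walkProd c p = (x : X)⁻¹ * y := by
  induction p with
  | nil => exact (inv_mul_cancel _).symm
  | cons h p ih =>
    change c (c.symm _) * _ = _
    rw [ih, Homeomorph.apply_symm_apply, mul_assoc, mul_inv_cancel_left]

theorem consistent_network (h : Connects H μ) (h_one : (1 : X) ∈ points μ) :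
    (h.network c h_one).Consistent c := fun _ _ p q =>
  (h.walkProd_network c h_one p).trans (h.walkProd_network c h_one q).symm

theorem transport_network (h : Connects H μ) (h_one : (1 : X) ∈ points μ) (x y : points μ) :
    (h.network c h_one).transport c x y = (x : X)⁻¹ * y := by
  obtain ⟨p⟩ := (h.network c h_one).connected.preconnected x y
  rw [(h.consistent_network c h_one).transport_eq p, walkProd_network]

theorem transport_network_one (h : Connects H μ) (h_one : (1 : X) ∈ points μ) (x : points μ) :
    (h.network c h_one).transport c ⟨1, h_one⟩ x = x := by
  rw [h.transport_network c h_one, inv_one, one_mul]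

variable [ContinuousMul X] [LocallyCompactSpace X] [SecondCountableTopology X] [T2Space X]
  [BorelSpace X]

theorem transportMeasure_network (h : Connects H μ) (h_one : (1 : X) ∈ points μ) :
    transportMeasure c (rooted (h.network c h_one) ⟨1, h_one⟩) = (μ : Measure X) := by
  refine (transportMeasure_rooted c.continuous _ _).trans ?_
  rw [h.isSimple.eq_sum_dirac]
  exact congrArg Measure.sum
    (funext fun x => congrArg Measure.dirac (h.transport_network_one c h_one x))

theorem rooted_network_mem_embeddableClasses (h : Connects H μ) (h_one : (1 : X) ∈ points μ) :
    rooted (h.network c h_one) ⟨1, h_one⟩ ∈ embeddableClasses c := by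
  refine ⟨rooted_mem_consistentClasses.2 (h.consistent_network c h_one), ?_⟩
  rw [mem_ofPred_eq, h.transportMeasure_network c h_one]
  exact μ.2.1

theorem embedding_network (h : Connects H μ) (h_one : (1 : X) ∈ points μ) :
    embedding c.continuous (rooted (h.network c h_one) ⟨1, h_one⟩) = μ :=
  Subtype.ext ((coe_embedding c.continuous (h.rooted_network_mem_embeddableClasses c h_one)).trans
    (h.transportMeasure_network c h_one))

theorem bijOn_transition (h : Connects H μ) (h_one : (1 : X) ∈ points μ) {K : Network Ξ} {o : K.V}
    (hK : rooted K o = rooted (h.network c h_one) ⟨1, h_one⟩) :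
    BijOn (fun v => transition c (birooted K o v)) univ (points μ) := by
  obtain ⟨φ, hφ⟩ := exists_markedIso_of_rooted_eq hK
  have h_transition : (fun v => transition c (birooted K o v)) =
      Subtype.val ∘ (φ.toIso.toEquiv : K.V ≃ points μ) := by
    ext v
    rw [transition_birooted (hK ▸ h.rooted_network_mem_embeddableClasses c h_one),
      φ.transport_eq, hφ]
    exact h.transport_network_one c h_one _
  rw [h_transition]
  refine ⟨fun v _ => Subtype.prop _, (Subtype.val_injective.comp (Equiv.injective _)).injOn,
    fun x hx => ?_⟩
  obtain ⟨v, hv⟩ := (φ.toIso.toEquiv : K.V ≃ points μ).surjective ⟨x, hx⟩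
  exact ⟨v, mem_univ v, congrArg Subtype.val hv⟩

end Connects

end PointNetwork

section RandomNetwork

variable {X : Type u} [Group X] [TopologicalSpace X] [MeasurableSpace X] {Ω : Type v}
  [MeasurableSpace Ω] [MulAction X Ω] {Ξ : Type u} [MetricSpace Ξ] (c : Ξ ≃ₜ X)
  {m : Ω → CountingMeasure X} {G : Ω → (⊤ : SimpleGraph X).Subgraph} {A : Set Ω}
  {E : Set (Ω × X × X)}

/-- The network consisting of a single vertex with mark `ξ`. -/
def trivialNetwork {Ξ : Type u} (ξ : Ξ) : Network Ξ where
  V := PUnit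
  graph := ⊤
  connected := SimpleGraph.connected_top
  locallyFinite _ := toFinite _
  vertexMark _ := ξ
  edgeMark _ _ := ξ

/-- The configurations in `A` with a point at the neutral element. -/
def rootedEvent (m : Ω → CountingMeasure X) (A : Set Ω) : Set Ω :=
  A ∩ {ω | (1 : X) ∈ points (m ω)}

/-- The configurations in `A` with points at the neutral element and at `x`. -/
def birootedEvent (m : Ω → CountingMeasure X) (A : Set Ω) : Set (Ω × X) :=
  {p | p.1 ∈ rootedEvent m A ∧ p.2 ∈ points (m p.1)}

namespace ConnectsOn

/-- The network on the points of a configuration in the rooted event. -/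
def network (h : ConnectsOn m G A E) {ω : Ω} (hω : ω ∈ rootedEvent m A) : Network Ξ :=
  (h.connects ω hω.1).network c hω.2

open Classical in
/-- The network with its first root at the neutral element and its second root at `x`, as a function
of `(ω, x)`; off the birooted event, the value is a fixed class. -/
noncomputable def birootedClass (h : ConnectsOn m G A E) (p : Ω × X) : NetworkClass Ξ 2 :=
  if hp : p ∈ birootedEvent m A then birooted (h.network c hp.1) ⟨1, hp.1.2⟩ ⟨p.2, hp.2⟩
  else birooted (trivialNetwork (c.symm 1)) PUnit.unit PUnit.unit

/-- The network seen from the neutral element. -/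
noncomputable def rootedClass (h : ConnectsOn m G A E) (ω : Ω) : NetworkClass Ξ 1 :=
  forget (h.birootedClass c (ω, 1))

theorem birootedClass_of_mem (h : ConnectsOn m G A E) {ω : Ω} (hω : ω ∈ rootedEvent m A)
    (x : points (m ω)) :
    h.birootedClass c (ω, x) = birooted (h.network c hω) ⟨1, hω.2⟩ x :=
  dif_pos (show (ω, (x : X)) ∈ birootedEvent m A from ⟨hω, x.2⟩)

theorem rootedClass_of_mem (h : ConnectsOn m G A E) {ω : Ω} (hω : ω ∈ rootedEvent m A) :
    h.rootedClass c ω = rooted (h.network c hω) ⟨1, hω.2⟩ :=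
  (congrArg forget (h.birootedClass_of_mem c hω ⟨1, hω.2⟩)).trans (forget_birooted _ _ _)

section Translation

variable [MeasurableSingletonClass X] [MeasurableMul X]

/-- Translation by `z` as an isomorphism of the networks at `ω` and at `z • ω`: the marks `x⁻¹ y`
are invariant under left translations. -/
def translation (h : ConnectsOn m G A E) (hfa : FlowAdapted m) {ω : Ω} (hω : ω ∈ rootedEvent m A)
    {z : X} (hz : z • ω ∈ rootedEvent m A) : MarkedIso (h.network c hω) (h.network c hz) where
  toIso :=
    { toFun := fun x : points (m ω) => ⟨z * x, (hfa.mul_mem_points_smul z ω x).2 x.2⟩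
      invFun := fun y : points (m (z • ω)) => ⟨z⁻¹ * y, (hfa.mul_mem_points_smul z ω _).1
        (by rw [mul_inv_cancel_left]; exact y.2)⟩
      left_inv := fun x => Subtype.ext (inv_mul_cancel_left z _)
      right_inv := fun y => Subtype.ext (mul_inv_cancel_left z _)
      map_rel_iff' := fun {x y} => ((h.equivariant z ω).2 _ _).symm }
  vertexMark_eq _ := rfl
  edgeMark_eq x y _ := by
    change c.symm (_⁻¹ * _) = c.symm ((z * _)⁻¹ * (z * _))
    rw [mul_inv_rev, mul_assoc, inv_mul_cancel_left]

theorem inv_smul_mem_rootedEvent (h : ConnectsOn m G A E) (hfa : FlowAdapted m) {ω : Ω}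
    (hω : ω ∈ A) {x : X} (hx : x ∈ points (m ω)) : x⁻¹ • ω ∈ rootedEvent m A :=
  ⟨h.smul_mem ω hω _, hfa.one_mem_points_inv_smul.2 hx⟩

theorem birootedClass_inv_smul (h : ConnectsOn m G A E) (hfa : FlowAdapted m) {ω : Ω}
    (hω : ω ∈ rootedEvent m A) (x : points (m ω)) :
    h.birootedClass c ((x : X)⁻¹ • ω, (x : X)⁻¹) =
      birooted (h.network c hω) x ⟨1, hω.2⟩ := by
  have hz := h.inv_smul_mem_rootedEvent hfa hω.1 x.2
  have hx_inv : (x : X)⁻¹ ∈ points (m ((x : X)⁻¹ • ω)) := by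
    simpa only [mul_one] using (hfa.mul_mem_points_smul (x : X)⁻¹ ω 1).2 hω.2
  refine (h.birootedClass_of_mem c hz ⟨_, hx_inv⟩).trans (Eq.trans ?_
    ((h.translation c hfa hω hz).birooted_eq x ⟨1, hω.2⟩).symm)
  exact congrArg₂ (birooted (h.network c hz)) (Subtype.ext (inv_mul_cancel (x : X)).symm)
    (Subtype.ext (mul_one (x : X)⁻¹).symm)

end Translation

section MassTransport

variable [LocallyCompactSpace X] [SecondCountableTopology X] [T2Space X] [BorelSpace X]

theorem massOut_rootedClass (h : ConnectsOn m G A E) (g : NetworkClass Ξ 2 → ℝ≥0∞) {ω : Ω}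
    (hω : ω ∈ rootedEvent m A) :
    massOut g (h.rootedClass c ω) = ∫⁻ x, g (h.birootedClass c (ω, x)) ∂(m ω : Measure X) := by
  rw [(h.connects ω hω.1).isSimple.lintegral_eq_tsum, h.rootedClass_of_mem c hω]
  refine (massOut_rooted g _ _).trans ?_
  exact tsum_congr fun x => congrArg g (h.birootedClass_of_mem c hω x).symm

theorem massIn_rootedClass [MeasurableMul X] (h : ConnectsOn m G A E) (hfa : FlowAdapted m)
    (g : NetworkClass Ξ 2 → ℝ≥0∞) {ω : Ω} (hω : ω ∈ rootedEvent m A) :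
    massIn g (h.rootedClass c ω) =
      ∫⁻ x, g (h.birootedClass c (x⁻¹ • ω, x⁻¹)) ∂(m ω : Measure X) := by
  rw [(h.connects ω hω.1).isSimple.lintegral_eq_tsum, h.rootedClass_of_mem c hω]
  refine (massIn_rooted g _ _).trans ?_
  exact tsum_congr fun x => congrArg g (h.birootedClass_inv_smul c hfa hω x).symm

end MassTransport

section Measurability

variable [IsTopologicalGroup X] [LocallyCompactSpace X] [SecondCountableTopology X] [T2Space X]
  [BorelSpace X]

theorem measurableSet_rootedEvent (h : ConnectsOn m G A E) (hm : Measurable m) :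
    MeasurableSet (rootedEvent m A) :=
  h.measurableSet.inter (measurableSet_mem_points hm measurable_const)

theorem measurableSet_birootedEvent (h : ConnectsOn m G A E) (hm : Measurable m) :
    MeasurableSet (birootedEvent m A) :=
  (measurable_fst (h.measurableSet_rootedEvent hm)).inter
    (measurableSet_mem_points (hm.comp measurable_fst) measurable_snd)

theorem measurable_birootedClass (h : ConnectsOn m G A E) (hm : Measurable m) :
    Measurable (h.birootedClass c) := by
  classical
  let _ : MeasurableSpace Ξ := borel Ξ
  have : BorelSpace Ξ := ⟨rfl⟩
  have : SecondCountableTopology Ξ := c.secondCountableTopology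
  have : Nonempty Ξ := ⟨c.symm 1⟩
  refine Measurable.dite (s := birootedEvent m A) (f := fun p =>
    birooted (h.network c p.2.1) ⟨1, p.2.1.2⟩ ⟨p.1.2, p.2.2⟩) (g := fun _ => _) ?_
    measurable_const (h.measurableSet_birootedEvent hm)
  have hE : MeasurableSet {q : birootedEvent m A × X × X | (q.1.1.1, q.2) ∈ E} :=
    (show Measurable fun q : birootedEvent m A × X × X => (q.1.1.1, q.2) by fun_prop)
      h.measurableSet_edges
  have h_roots : Measurable fun p : birootedEvent m A => ![1, p.1.2] := by
    refine measurable_pi_iff.2 fun l => ?_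
    fin_cases l
    · exact measurable_const
    · exact measurable_snd.comp measurable_subtype_coe
  have h_edgeMark : Measurable fun q : birootedEvent m A × X × X => c.symm (q.2.1⁻¹ * q.2.2) :=
    c.symm.continuous.measurable.comp (by fun_prop)
  refine measurable_mk_of_isPlacement (μ := fun p : birootedEvent m A => m p.1.1)
    (a := fun _ _ => c.symm 1) (b := fun _ x y => c.symm (x⁻¹ * y)) (ι := fun _ => Subtype.val)
    (hm.comp (measurable_fst.comp measurable_subtype_coe)) hE h_roots measurable_const h_edgeMark
    fun p => ⟨Subtype.val_injective, Subtype.range_coe, fun v w =>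
      (h.adj_iff p.1.1 p.2.1.1 _ _).symm, fun l => ?_, fun _ => rfl, fun _ _ _ => rfl⟩
  fin_cases l <;> rfl

theorem measurable_rootedClass (h : ConnectsOn m G A E) (hm : Measurable m) :
    Measurable (h.rootedClass c) :=
  continuous_forget.measurable.comp
    ((h.measurable_birootedClass c hm).comp measurable_prodMk_right)

variable [MeasurableSMul₂ X Ω]

theorem ae_palm_mem_rootedEvent (h : ConnectsOn m G A E) (hm : Measurable m) (hfa : FlowAdapted m)
    {P : Measure Ω} {μ : Measure X} {w : X → ℝ≥0} (hw : Measurable w) (hA : ∀ᵐ ω ∂P, ω ∈ A) :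
    ∀ᵐ ω ∂(palm P μ m w), ω ∈ rootedEvent m A := by
  refine ae_palm_of_ae_forall_mem_points hm hw (h.measurableSet_rootedEvent hm) ?_
  filter_upwards [hA] with ω hω x hx using h.inv_smul_mem_rootedEvent hfa hω hx

theorem isUnimodularNetwork (h : ConnectsOn m G A E) (hm : Measurable m) (hfa : FlowAdapted m)
    {P : Measure Ω} [SFinite P] [SMulInvariantMeasure X Ω P] {μ : Measure X} [μ.IsHaarMeasure]
    [μ.IsMulRightInvariant] [IsLocallyFiniteMeasure (meanMeasure P m)] (h0 : meanMeasure P m ≠ 0)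
    {w : X → ℝ≥0} (hw : Measurable w) (hw_one : ∫⁻ x, (w x : ℝ≥0∞) ∂μ = 1)
    (hA : ∀ᵐ ω ∂(palm P μ m w), ω ∈ rootedEvent m A) :
    IsUnimodularNetwork (palm P μ m w) (h.rootedClass c) where
  isProbabilityMeasure := isProbabilityMeasure_palm hm hfa h0 hw hw_one
  measurable := h.measurable_rootedClass c hm
  massTransport g hg :=
    calc ∫⁻ ω, massOut g (h.rootedClass c ω) ∂(palm P μ m w)
        = ∫⁻ ω, ∫⁻ x, g (h.birootedClass c (ω, x)) ∂(m ω : Measure X) ∂(palm P μ m w) :=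
          lintegral_congr_ae (hA.mono fun _ => h.massOut_rootedClass c g)
      _ = ∫⁻ ω, ∫⁻ x, g (h.birootedClass c (x⁻¹ • ω, x⁻¹)) ∂(m ω : Measure X)
            ∂(palm P μ m w) :=
          palm_exchange hm hfa hw hw_one (hg.comp (h.measurable_birootedClass c hm))
      _ = ∫⁻ ω, massIn g (h.rootedClass c ω) ∂(palm P μ m w) :=
          lintegral_congr_ae (hA.mono fun _ hω => (h.massIn_rootedClass c hfa g hω).symm)

end Measurability

section Embedding

variable [ContinuousMul X] [LocallyCompactSpace X] [SecondCountableTopology X] [T2Space X]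
  [BorelSpace X]

theorem embedding_rootedClass (h : ConnectsOn m G A E) {ω : Ω} (hω : ω ∈ rootedEvent m A) :
    embedding c.continuous (h.rootedClass c ω) = m ω := by
  rw [h.rootedClass_of_mem c hω]
  exact (h.connects ω hω.1).embedding_network c hω.2

theorem isEmbedding (h : ConnectsOn m G A E) {Q : Measure Ω}
    (hA : ∀ᵐ ω ∂Q, ω ∈ rootedEvent m A) :
    IsEmbedding Q (h.rootedClass c) (embedding c.continuous) where
  measurable := measurable_embedding c.continuous
  one_mem := one_mem_points_embedding c.continuous
  exists_transition := by
    refine ⟨transition c, measurable_transition c.continuous, fun K o v =>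
      ⟨embedding_rooted_eq_leftTranslate c.continuous K o v,
        transition_symm c.continuous K o v⟩, ?_⟩
    filter_upwards [hA] with ω hω K o hK
    rw [h.embedding_rootedClass c hω]
    exact (h.connects ω hω.1).bijOn_transition c hω.2 (hK.symm.trans (h.rootedClass_of_mem c hω))

end Embedding

end ConnectsOn

end RandomNetwork

end PalmNetwork

theorem mainTheorem10_general
    {X : Type u} [Group X] [TopologicalSpace X] [IsTopologicalGroup X]
    [LocallyCompactSpace X] [SecondCountableTopology X] [T2Space X]
    [MeasurableSpace X] [BorelSpace X]
    (haar : Measure X) [haar.IsHaarMeasure] [haar.IsMulRightInvariant]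
    {Ω : Type v} [MeasurableSpace Ω] (P : Measure Ω) [SFinite P]
    [MulAction X Ω] [MeasurableSMul₂ X Ω] [SMulInvariantMeasure X Ω P]
    (m : Ω → CountingMeasure X) (measurable_m : Measurable m)
    (flowAdapted : FlowAdapted m) (simple : ∀ᵐ ω ∂P, IsSimple (m ω))
    [IsLocallyFiniteMeasure (meanMeasure P m)] (nonzero : meanMeasure P m ≠ 0)
    (connectible : Connectible P m)
    (w : X → ℝ≥0) (measurable_w : Measurable w) (integral_w : ∫⁻ x, (w x : ℝ≥0∞) ∂haar = 1) :
    ∃ (Ξ : Type u) (_ : MetricSpace Ξ) (_ : CompleteSpace Ξ)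
      (_ : TopologicalSpace.SeparableSpace Ξ) (Γ : Ω → NetworkClass Ξ 1),
      IsUnimodularNetwork (palm P haar m w) Γ ∧
      ∃ ψ : NetworkClass Ξ 1 → CountingMeasure X,
        IsEmbedding (palm P haar m w) Γ ψ ∧ ∀ᵐ ω ∂(palm P haar m w), m ω = ψ (Γ ω) := by
  obtain ⟨G, A, E, h, hA⟩ := connectible.exists_connectsOn haar flowAdapted simple
  have h_rooted := h.ae_palm_mem_rootedEvent measurable_m flowAdapted (μ := haar) measurable_w hA
  obtain ⟨Ξ, mΞ, h_complete, h_separable, ⟨c⟩⟩ : ∃ (Ξ : Type u) (_ : MetricSpace Ξ)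
      (_ : CompleteSpace Ξ) (_ : TopologicalSpace.SeparableSpace Ξ), Nonempty (Ξ ≃ₜ X) := by
    have := isCompletelyMetrizableSpace_of_locallyCompactSpace X
    let _ := TopologicalSpace.upgradeIsCompletelyMetrizable X
    exact ⟨X, inferInstance, inferInstance, inferInstance, ⟨Homeomorph.refl X⟩⟩
  have h_unimodular := h.isUnimodularNetwork c measurable_m flowAdapted nonzero measurable_w
    integral_w h_rooted
  have h_embedding : ∀ᵐ ω ∂(palm P haar m w), m ω = embedding c.continuous (h.rootedClass c ω) :=
    h_rooted.mono fun _ hω => (h.embedding_rootedClass c hω).symm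
  exact ⟨Ξ, mΞ, h_complete, h_separable, h.rootedClass c, h_unimodular, embedding c.continuous,
    h.isEmbedding c h_rooted, h_embedding⟩

theorem mainTheorem10
    {X : Type u} [Group X] [TopologicalSpace X] [IsTopologicalGroup X]
    [LocallyCompactSpace X] [SecondCountableTopology X] [T2Space X]
    [MeasurableSpace X] [BorelSpace X]
    (haar : Measure X) [haar.IsHaarMeasure]
    (unimodular : ∀ (x : X) (B : Set X), MeasurableSet B → haar ((fun y => y * x) '' B) = haar B)
    {Ω : Type v} [MeasurableSpace Ω] (P : Measure Ω) [IsProbabilityMeasure P]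
    [MulAction X Ω] [MeasurableSMul₂ X Ω] [SMulInvariantMeasure X Ω P]
    (m : Ω → CountingMeasure X) (measurable_m : Measurable m)
    (flowAdapted : FlowAdapted m) (simple : ∀ᵐ ω ∂P, IsSimple (m ω))
    (locallyFinite : IsLocallyFiniteMeasure (meanMeasure P m)) (nonzero : meanMeasure P m ≠ 0)
    (connectible : Connectible P m)
    (w : X → ℝ≥0) (measurable_w : Measurable w) (integral_w : ∫⁻ x, (w x : ℝ≥0∞) ∂haar = 1) :
    ∃ (Ξ : Type u) (_ : MetricSpace Ξ) (_ : CompleteSpace Ξ)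
      (_ : TopologicalSpace.SeparableSpace Ξ) (Γ : Ω → NetworkClass Ξ 1),
      IsUnimodularNetwork (palm P haar m w) Γ ∧
      ∃ ψ : NetworkClass Ξ 1 → CountingMeasure X,
        IsEmbedding (palm P haar m w) Γ ψ ∧ ∀ᵐ ω ∂(palm P haar m w), m ω = ψ (Γ ω) := by
  have := isMulRightInvariant_of_measure_image unimodular
  exact mainTheorem10_general haar P m measurable_m flowAdapted simple nonzero connectible w
    measurable_w integral_w
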